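/- Let $p$ be an odd prime, $\mathbb F_q$ a finite field of characteristic $p$, and $\psi$ a non-trivial additive character of $\mathbb F_p$. For $p\nmid d$ let $\mathcal F_d'$ be the set of polynomials $f=\sum_{i=0}^d a_iX^i\in\mathbb F_q[X]$ with $a_d\neq 0$ and $a_{pk}=0$ for $1\le k\le\lfloor d/p\rfloor$, and write $\langle\phi(f)\rangle=\frac1{|\mathcal F_d'|}\sum_{f\in\mathcal F_d'}\phi(f)$. For $k\ge1$ put $S_k(f,\psi)=\sum_{x\in\mathbb F_{q^k}}\psi(\mathrm{tr}_k f(x))$, where $\mathrm{tr}_k:\mathbb F_{q^k}\to\mathbb F_p$ is the absolute trace. Let $\mathcal I=[-\beta/2,\beta/2]$ with $0<\beta<1$, so $|\mathcal I|=\beta$, and let $I_K^{+}$ and $I_K^-$ be the Beurling–Selberg majorant and minorant of degree $K$ of the indicator function of $\mathcal I$ (modulo $1$), that is, with $e(x)=e^{2\pi i x}$, \[I_K^+(x)=\beta+B_K(x-\tfrac\beta2)+B_K(-\tfrac\beta2-x),\qquad I_K^-(x)=\beta-B_K(\tfrac\beta2-x)-B_K(x+\tfrac\beta2),\] \[B_K(x)=-\sum_{k=1}^K\rho\!\left(\tfrac{k}{K+1}\right)\frac{\sin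 2\pi kx}{\pi k}+\frac1{2(K+1)}\sum_{|k|\le K}\Bigl(1-\frac{|k|}{K+1}\Bigr)e(kx),\qquad \rho(t)=\pi t(1-t)\cot(\pi t)+t .\] With $\widehat I_K^\pm(k)=\int_{-1/2}^{1/2}I_K^\pm(x)e(-kx)\,dx$, put \[S^\pm(K,f,\psi)=\sum_{k=1}^K\frac{\widehat I_K^\pm(k)S_k(f,\psi)+\widehat I_K^\pm(-k)S_k(f,\bar\psi)}{q^{k/2}},\qquad C=C(\beta)=\sum_{k\ge1,\ p\mid k}\frac{\sin(\pi k\beta)}{\pi k}\,q^{-(1/2-1/p)k}.\] Let $\eta<1$ and let $n\ge1$ be an integer. Then, for all non-trivial $\psi$, all $0<\beta\le\eta$, all $d$ with $p\nmid d$, and all integers $K$ with $\max\{1,1/|\mathcal I|\}<K<d/n$, \[\left\langle S^\pm(K,f,\psi)^n\right\rangle=\begin{cases}\dfrac{(2\ell)!}{\ell!(2\pi^2)^\ell}\log^\ell(K|\mathcal I|)+O\!\left((1+\log(K|\mathcal I|))^{\ell-1}\right), & n=2\ell,\\[3mm] 2C\,\dfrac{(2\ell+1)!}{\ell!(2\pi^2)^\ell}\log^\ell(K|\mathcal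 I|)+O\!\left(|\mathcal I|\,(1+\log(K|\mathcal I|))^{\ell-1}\right), & n=2\ell+1,\end{cases}\] for both choices of the sign $\pm$, where the implied constants depend only on $\mathbb F_q$, $n$ and $\eta$. In particular, in any range $K|\mathcal I|\ge c>1$, the right-hand sides are the displayed main terms times $1+O(1/\log(K|\mathcal I|))$; in the case of odd $n$ this holds as long as $|C|\ge\delta|\mathcal I|$ for a fixed $\delta>0$ (for instance, for fixed $\beta$ with $p\beta\notin\mathbb Z$, or uniformly for $\beta\to0$). -/

import Mathlib

noncomputable section

namespace ArtinSchreier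

open Polynomial

/-! ### The family of polynomials and averages over it -/

/-- Polynomials over `F` of degree exactly `d` (for `d ≥ 1`) all of whose coefficients at the
positive multiples of `p` vanish. -/
def family (F : Type*) [Field F] (p d : ℕ) : Set F[X] :=
  {f | f.natDegree = d ∧ ∀ k : ℕ, 1 ≤ k → k ≤ d / p → f.coeff (p * k) = 0}

theorem family_finite (F : Type*) [Field F] [Finite F] (p d : ℕ) : (family F p d).Finite := by
  have hfin : Finite (Polynomial.degreeLT F (d + 1)) :=
    Finite.of_equiv _ (Polynomial.degreeLTEquiv F (d + 1)).toEquiv.symm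
  refine Set.Finite.subset (s := (Polynomial.degreeLT F (d + 1) : Set F[X]))
    (Set.toFinite _) ?_
  intro f hf
  have h1 : f.natDegree = d := hf.1
  rw [SetLike.mem_coe, Polynomial.mem_degreeLT]
  exact lt_of_le_of_lt Polynomial.degree_le_natDegree (by rw [h1]; exact_mod_cast Nat.lt_succ_self d)

/-- The average `⟨φ(f)⟩` of `φ` over the family. -/
def average (F : Type*) [Field F] [Finite F] (p d : ℕ) (φ : F[X] → ℂ) : ℂ :=
  (∑ f ∈ (family_finite F p d).toFinset, φ f) / ((family F p d).ncard : ℂ)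

/-! ### Character sums -/

/-- `S_k(f, ψ) = ∑_{x ∈ 𝔽_{q^k}} ψ(tr f(x))` with the absolute trace `tr : 𝔽_{q^k} → 𝔽_p`. -/
def charSum (p : ℕ) [Fact p.Prime] (F : Type*) [Field F] [Finite F] [CharP F p]
    (k : ℕ) [NeZero k] (f : F[X]) (ψ : AddChar (ZMod p) ℂ) : ℂ :=
  ∑ᶠ x : FiniteField.Extension F p k,
    ψ (Algebra.trace (ZMod p) (FiniteField.Extension F p k) (Polynomial.aeval x f))

/-! ### Beurling-Selberg polynomials

They are built from Vaaler's approximation to the sawtooth `{x} - 1/2`, as in Chapter 1 of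
Montgomery's "Ten lectures". -/

/-- Vaaler's weight `πt(1-t) cot(πt) + t`, for `0 < t < 1`. -/
def vaalerWeight (t : ℝ) : ℝ :=
  Real.pi * t * (1 - t) * Real.cot (Real.pi * t) + t

/-- Vaaler's polynomial of degree `K`, approximating `{x} - 1/2 = -∑_{k ≥ 1} sin(2πkx)/(πk)`. -/
def vaaler (K : ℕ) (x : ℝ) : ℝ :=
  -∑ k ∈ Finset.Icc 1 K,
    vaalerWeight ((k : ℝ) / ((K : ℝ) + 1)) * Real.sin (2 * Real.pi * k * x) / (Real.pi * k)

/-- The Fejér kernel `∑_{|k| ≤ K} (1 - |k|/(K+1)) e(kx)`. -/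
def fejer (K : ℕ) (x : ℝ) : ℝ :=
  1 + 2 * ∑ k ∈ Finset.Icc 1 K, (1 - (k : ℝ) / ((K : ℝ) + 1)) * Real.cos (2 * Real.pi * k * x)

/-- Beurling's polynomial of degree `K`, a majorant of the sawtooth. -/
def beurling (K : ℕ) (x : ℝ) : ℝ :=
  vaaler K x + fejer K x / (2 * ((K : ℝ) + 1))

/-- The Beurling-Selberg majorant `I_K^+` of the indicator of `[-β/2, β/2]` modulo `1`. -/
def selbergMajorant (K : ℕ) (β : ℝ) (x : ℝ) : ℝ :=
  β + beurling K (x - β / 2) + beurling K (-β / 2 - x)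

/-- The Beurling-Selberg minorant `I_K^-` of the indicator of `[-β/2, β/2]` modulo `1`. -/
def selbergMinorant (K : ℕ) (β : ℝ) (x : ℝ) : ℝ :=
  β - beurling K (β / 2 - x) - beurling K (x + β / 2)

/-- The Fourier coefficient `∫_{-1/2}^{1/2} h(x) e(-kx) dx`. -/
def fourierCoef (h : ℝ → ℝ) (k : ℤ) : ℂ :=
  ∫ x in (-(1 / 2 : ℝ))..(1 / 2 : ℝ),
    (h x : ℂ) * Complex.exp (-(2 * Real.pi * Complex.I * (k : ℂ) * (x : ℂ)))

/-! ### The sums `S^±(K, f, ψ)` and the constant `C` -/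

/-- `∑_{k=1}^K (ĥ(k) S_k(f, ψ) + ĥ(-k) S_k(f, ψ̄)) / q^{k/2}`, which is `S^±(K, f, ψ)` for
`h = I_K^±`; the index below is `j = k - 1`, and `ψ⁻¹ = ψ̄`. -/
def weightedSum (p : ℕ) [Fact p.Prime] (F : Type*) [Field F] [Finite F] [CharP F p]
    (h : ℝ → ℝ) (K : ℕ) (f : F[X]) (ψ : AddChar (ZMod p) ℂ) : ℂ :=
  ∑ j ∈ Finset.range K,
    (fourierCoef h ((j + 1 : ℕ) : ℤ) * charSum p F (j + 1) f ψ
        + fourierCoef h (-((j + 1 : ℕ) : ℤ)) * charSum p F (j + 1) f ψ⁻¹)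
      / (((Nat.card F : ℝ) ^ (((j + 1 : ℕ) : ℝ) / 2) : ℝ) : ℂ)

/-- `C = ∑_{k ≥ 1, p ∣ k} sin(πkβ)/(πk) · q^{-(1/2 - 1/p)k}`, an absolutely convergent series
for `p > 2`, `q > 1`; the index below is `j = k - 1`. -/
def constC (p q : ℕ) (β : ℝ) : ℝ :=
  ∑' j : ℕ, if p ∣ (j + 1) then
    Real.sin (Real.pi * ((j + 1 : ℕ) : ℝ) * β) / (Real.pi * ((j + 1 : ℕ) : ℝ))
      * (q : ℝ) ^ (-((1 / 2 - 1 / (p : ℝ)) * ((j + 1 : ℕ) : ℝ)))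
  else 0

end ArtinSchreier

end

/-! Grouping the elements of 𝔽_{q^k} by minimal polynomial (`trace_aeval_eq`, `charSum_eq`) turns
S_k into a sum over closed points P of degree m ∣ k of m·ψ((k/m)·tr_P f), where tr_P f is the trace
to 𝔽_p of the residue of f at P. Hence S^±(K, f, ψ) is a sum over the P of degree at most K of
functions of the single variables tr_P f (`weightedSum_eq`).

Any n such points have total degree at most nK < d. The Chinese remainder theorem gives a polynomial
of degree less than d with prescribed residues. Its monomials of exponent divisible by p can be
reduced without changing local traces, because tr_P(g^p) = tr_P(g). Translating the family by the
result shows that the traces at n points are jointly uniform (`average_prod_localTrace`). The n-th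
moment is therefore exactly that of a sum of independent variables, one for each P.

For independent variables the exponential generating functions multiply, so their logarithmic
derivatives, whose coefficients are cumulants up to factorials, add. With N_m points of degree m and
Σ_{m ∣ k} m N_m = q^k: the mean is 2C + O(1/K), since only multiplicities r divisible by p survive
averaging, and Σ_{m ∣ k/p} m N_m = q^{k/p} (`exists_norm_cumulant_zero_sub_le`); the variance is
log(Kβ)/π² + O(1), essentially the sum of 2 sin²(πmβ)/(π²m) over m ≤ K
(`exists_norm_cumulant_one_sub_le`); every higher cumulant is O(β), because m N_m is at most q^m
while three or more local factors q^{-m/2} appear (`exists_norm_cumulant_le`).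

The relation M' = (M'/M)·M is a recursion for the moments. With τ = log(Kβ)/(2π²) it gives τ^ℓ/ℓ!
for the coefficient of order 2ℓ and 2C·τ^ℓ/ℓ! for that of order 2ℓ + 1, up to the stated errors
(`moment_asymptotics`). The error of the mean is harmless even relative to β, since 1 + log(Kβ) ≤
Kβ. -/

noncomputable section

namespace ArtinSchreier

/-! ### Closed points of the affine line and local traces -/

section ClosedPoints

open Polynomial

/-- The trace to the prime field of the residue of `f` at the closed point `P`. -/
def localTrace (p : ℕ) [Fact p.Prime] {F : Type*} [Field F] [Algebra (ZMod p) F]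
    (P f : F[X]) : ZMod p :=
  Algebra.trace (ZMod p) (AdjoinRoot P) (AdjoinRoot.mk P f)

/-- The monic irreducible polynomials of degree `m`. -/
def closedPoints (F : Type*) [Field F] [Finite F] (m : ℕ) : Finset F[X] :=
  (Set.Finite.subset (s := (Polynomial.degreeLT F (m + 1) : Set F[X]))
    (t := {P | P.Monic ∧ Irreducible P ∧ P.natDegree = m})
    (have : Finite (Polynomial.degreeLT F (m + 1)) :=
      Finite.of_equiv _ (Polynomial.degreeLTEquiv F (m + 1)).toEquiv.symm
    Set.toFinite _) (by
      rintro P ⟨-, -, h⟩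
      rw [SetLike.mem_coe, Polynomial.mem_degreeLT]
      exact Polynomial.degree_le_natDegree.trans_lt
        (by rw [h]; exact_mod_cast Nat.lt_succ_self m))).toFinset

theorem mem_closedPoints {F : Type*} [Field F] [Finite F] {m : ℕ} {P : F[X]} :
    P ∈ closedPoints F m ↔ P.Monic ∧ Irreducible P ∧ P.natDegree = m := by
  simp [closedPoints]

theorem localTrace_add (p : ℕ) [Fact p.Prime] {F : Type*} [Field F] [Algebra (ZMod p) F]
    (P f g : F[X]) : localTrace p P (f + g) = localTrace p P f + localTrace p P g := by
  simp [localTrace]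

section Trace

variable (p : ℕ) [Fact p.Prime] {F : Type*} [Field F] [Finite F] [Algebra (ZMod p) F]

/-- Transitivity of the trace through the subfield F(x), identified with `AdjoinRoot (minpoly F x)`:
the value of f at x already lies there, so the upper trace is multiplication by the degree of E over
F(x). -/
theorem trace_aeval_eq {E : Type*} [Field E] [Algebra F E] [FiniteDimensional F E]
    [Algebra (ZMod p) E] [IsScalarTower (ZMod p) F E] (x : E) (f : F[X]) :
    Algebra.trace (ZMod p) E (aeval x f) =
      ((Module.finrank F E / (minpoly F x).natDegree : ℕ) : ZMod p)
        * localTrace p (minpoly F x) f := by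
  set P := minpoly F x with hP
  have hint : IsIntegral F x := IsIntegral.of_finite F x
  have hirr : Irreducible P := minpoly.irreducible hint
  have : Fact (Irreducible P) := ⟨hirr⟩
  let φ : AdjoinRoot P →ₐ[F] E := AdjoinRoot.liftAlgHom P (Algebra.ofId F E) x (by
    simpa [aeval_def] using minpoly.aeval F x)
  let _ : Algebra (AdjoinRoot P) E := φ.toRingHom.toAlgebra
  have : IsScalarTower F (AdjoinRoot P) E := IsScalarTower.of_algebraMap_eq fun a => by
    change algebraMap F E a = φ (algebraMap F (AdjoinRoot P) a)
    rw [φ.commutes]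
  have : IsScalarTower (ZMod p) (AdjoinRoot P) E :=
    .of_algebraMap_eq' <| Subsingleton.elim _ _
  have : FiniteDimensional F (AdjoinRoot P) := (AdjoinRoot.powerBasis hirr.ne_zero).finite
  have : FiniteDimensional (ZMod p) F := Module.Finite.of_finite
  have : FiniteDimensional (ZMod p) (AdjoinRoot P) := Module.Finite.trans F _
  have : FiniteDimensional (AdjoinRoot P) E := Module.Finite.of_restrictScalars_finite F _ _
  have hφ : aeval x f = algebraMap (AdjoinRoot P) E (AdjoinRoot.mk P f) := by
    change _ = φ (AdjoinRoot.mk P f)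
    simp [φ, AdjoinRoot.liftAlgHom_mk, aeval_def]
  have hdeg : Module.finrank F (AdjoinRoot P) = P.natDegree :=
    finrank_quotient_span_eq_natDegree (f := P)
  have hmul := Module.finrank_mul_finrank F (AdjoinRoot P) E
  rw [hdeg] at hmul
  have hpos : 0 < P.natDegree := hirr.natDegree_pos
  rw [hφ, ← Algebra.trace_trace (S := AdjoinRoot P), Algebra.trace_algebraMap, map_nsmul,
    nsmul_eq_mul, ← hmul, Nat.mul_div_cancel_left _ hpos]
  rfl

/-- Frobenius is an automorphism of the residue field over 𝔽_p, so it preserves the trace. This is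
why omitting the coefficients at positive multiples of p costs no local information. -/
theorem localTrace_pow (P f : F[X]) (hP : Irreducible P) :
    localTrace p P (f ^ p) = localTrace p P f := by
  have : Fact (Irreducible P) := ⟨hP⟩
  have : FiniteDimensional F (AdjoinRoot P) := (AdjoinRoot.powerBasis hP.ne_zero).finite
  have : Finite (AdjoinRoot P) := Module.finite_of_finite F
  have : CharP (AdjoinRoot P) p := charP_of_injective_algebraMap
    (algebraMap (ZMod p) (AdjoinRoot P)).injective p
  have : ExpChar (AdjoinRoot P) p := ExpChar.prime Fact.out
  have := Algebra.trace_eq_of_algEquiv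
    (FiniteField.frobeniusAlgEquiv (ZMod p) (AdjoinRoot P) p) (AdjoinRoot.mk P f)
  rw [FiniteField.frobeniusAlgEquiv_apply, ZMod.card] at this
  rw [localTrace, map_pow, this, localTrace]

theorem exists_trace_eq (P : F[X]) (hP : Irreducible P) (c : ZMod p) :
    ∃ f : F[X], localTrace p P f = c := by
  have : Fact (Irreducible P) := ⟨hP⟩
  have : FiniteDimensional F (AdjoinRoot P) := (AdjoinRoot.powerBasis hP.ne_zero).finite
  have : Finite (AdjoinRoot P) := Module.finite_of_finite F
  have : FiniteDimensional (ZMod p) (AdjoinRoot P) := Module.Finite.of_finite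
  obtain ⟨y, hy⟩ := Algebra.trace_surjective (ZMod p) (AdjoinRoot P) c
  obtain ⟨f, rfl⟩ := AdjoinRoot.mk_surjective y
  exact ⟨f, hy⟩

end Trace

/-! ### Sums over an extension field grouped by minimal polynomial -/

section Count

/-- P divides X^{#E} - X, hence splits in E; it is separable because finite fields are perfect; its
roots are exactly the elements with minimal polynomial P. -/
theorem card_filter_minpoly {F E : Type*} [Field F] [Finite F] [Field E] [Fintype E] [Algebra F E]
    [DecidableEq F[X]] (P : F[X]) (hP : P.Monic) (hirr : Irreducible P)
    (hdvd : P.natDegree ∣ Module.finrank F E) :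
    (Finset.univ.filter fun x : E => minpoly F x = P).card = P.natDegree := by
  have hsplit : (P.map (algebraMap F E)).Splits := by
    have h := hirr.natDegree_dvd_iff_dvd_X_pow_card_pow_sub_X.1 hdvd
    have hc : Nat.card F ^ Module.finrank F E = Fintype.card E := by
      rw [Fintype.card_eq_nat_card, Module.natCard_eq_pow_finrank (K := F) (V := E)]
    rw [hc] at h
    refine Splits.of_dvd (FiniteField.isSplittingField_sub E F).splits ?_
      (map_dvd (algebraMap F E) h)
    exact map_ne_zero (FiniteField.X_pow_card_sub_X_ne_zero _ Fintype.one_lt_card)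
  have h := card_rootSet_eq_natDegree (K := E) (PerfectField.separable_of_irreducible hirr) hsplit
  rw [← h, ← Fintype.card_coe]
  refine Fintype.card_congr (Equiv.subtypeEquivRight fun x => ?_)
  rw [mem_rootSet]
  simp only [Finset.mem_filter, Finset.mem_univ, true_and]
  constructor
  · rintro rfl
    exact ⟨hirr.ne_zero, minpoly.aeval F x⟩
  · rintro ⟨-, h0⟩
    exact (minpoly.eq_of_irreducible_of_monic hirr h0 hP).symm

theorem sum_minpoly {F E : Type*} [Field F] [Finite F] [Field E] [Fintype E] [Algebra F E]
    (g : F[X] → ℂ) :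
    ∑ x : E, g (minpoly F x) =
      ∑ m ∈ (Module.finrank F E).divisors, ∑ P ∈ closedPoints F m, (m : ℂ) * g P := by
  classical
  have hfin : FiniteDimensional F E := Module.Finite.of_finite
  rw [← Finset.sum_fiberwise_of_maps_to (s := Finset.univ)
    (t := (Module.finrank F E).divisors) (g := fun x : E => (minpoly F x).natDegree)]
  · refine Finset.sum_congr rfl fun m hm => ?_
    rw [← Finset.sum_fiberwise_of_maps_to (t := closedPoints F m) (g := fun x : E => minpoly F x)]
    · refine Finset.sum_congr rfl fun P hP => ?_
      rw [mem_closedPoints] at hP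
      obtain ⟨h1, h2, h3⟩ := hP
      have hc := card_filter_minpoly (E := E) P h1 h2 (h3 ▸ Nat.dvd_of_mem_divisors hm)
      rw [Finset.filter_filter]
      have : (Finset.univ.filter fun x : E => (minpoly F x).natDegree = m ∧ minpoly F x = P)
          = Finset.univ.filter fun x : E => minpoly F x = P := by
        ext x
        simp only [Finset.mem_filter, Finset.mem_univ, true_and, and_iff_right_iff_imp]
        rintro rfl
        exact h3
      rw [this, Finset.sum_congr rfl (g := fun _ => g P), Finset.sum_const, hc, h3, nsmul_eq_mul]
      intro x hx
      rw [(Finset.mem_filter.1 hx).2]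
    · intro x hx
      rw [mem_closedPoints]
      have hint : IsIntegral F x := IsIntegral.of_finite F x
      exact ⟨minpoly.monic hint, minpoly.irreducible hint, (Finset.mem_filter.1 hx).2⟩
  · intro x _
    rw [Nat.mem_divisors]
    exact ⟨minpoly.degree_dvd (IsIntegral.of_finite F x), Module.finrank_pos.ne'⟩

/-- Counting elements of the degree `k` extension by their minimal polynomials. -/
theorem sum_divisors_card_closedPoints (p : ℕ) [Fact p.Prime] (F : Type*) [Field F] [Finite F]
    [CharP F p] (k : ℕ) (hk : k ≠ 0) :
    ∑ m ∈ k.divisors, m * (closedPoints F m).card = Nat.card F ^ k := by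
  have : NeZero k := ⟨hk⟩
  have := Fintype.ofFinite (FiniteField.Extension F p k)
  have h := sum_minpoly (F := F) (E := FiniteField.Extension F p k) (fun _ => 1)
  rw [FiniteField.finrank_extension] at h
  simp only [Finset.sum_const, Finset.card_univ, nsmul_eq_mul, mul_one,
    Fintype.card_eq_nat_card, FiniteField.natCard_extension] at h
  have h' : ((∑ m ∈ k.divisors, m * (closedPoints F m).card : ℕ) : ℂ)
      = ((Nat.card F ^ k : ℕ) : ℂ) := by
    rw [h]; push_cast
    exact Finset.sum_congr rfl fun m _ => mul_comm _ _
  exact_mod_cast h'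

theorem charSum_eq (p : ℕ) [Fact p.Prime] (F : Type*) [Field F] [Finite F]
    [CharP F p] [Algebra (ZMod p) F] (k : ℕ) [NeZero k] (f : F[X]) (ψ : AddChar (ZMod p) ℂ) :
    charSum p F k f ψ = ∑ m ∈ k.divisors, ∑ P ∈ closedPoints F m,
      (m : ℂ) * ψ (((k / m : ℕ) : ZMod p) * localTrace p P f) := by
  have := Fintype.ofFinite (FiniteField.Extension F p k)
  rw [charSum, finsum_eq_sum_of_fintype]
  simp_rw [trace_aeval_eq p (F := F)]
  rw [FiniteField.finrank_extension]
  rw [sum_minpoly (fun P => ψ (((k / P.natDegree : ℕ) : ZMod p) * localTrace p P f)),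
    FiniteField.finrank_extension]
  refine Finset.sum_congr rfl fun m _ => Finset.sum_congr rfl fun P hP => ?_
  rw [(mem_closedPoints.1 hP).2.2]

end Count

/-! ### Translations of the family and equidistribution of local traces -/

theorem add_mem_family (p : ℕ) {F : Type*} [Field F] (d : ℕ) (hd : d ≠ 0) {f g : F[X]} (hf : f ∈ family F p d)
    (hg : g.degree < d) (hg' : ∀ k, 1 ≤ k → g.coeff (p * k) = 0) : f + g ∈ family F p d := by
  obtain ⟨h1, h2⟩ := hf
  refine ⟨?_, fun k hk hkd => by rw [coeff_add, h2 k hk hkd, hg' k hk, add_zero]⟩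
  have hf0 : f ≠ 0 := by
    rintro rfl
    exact hd (by simpa using h1.symm)
  have : f.degree = d := by rw [degree_eq_natDegree hf0, h1]
  rw [natDegree_eq_of_degree_eq (degree_add_eq_left_of_degree_lt (this ▸ hg)), h1]

theorem family_nonempty (p : ℕ) {F : Type*} [Field F] (d : ℕ) (hd : d ≠ 0) (hpd : ¬ p ∣ d) : (family F p d).Nonempty := by
  refine ⟨X ^ d, natDegree_X_pow d, fun k _ _ => ?_⟩
  rw [coeff_X_pow, if_neg]
  rintro rfl
  exact hpd (dvd_mul_right _ _)

section Equidistribution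

variable (p : ℕ) [Fact p.Prime] {F : Type*} [Field F] [Finite F] [Algebra (ZMod p) F]

/-- Since Frobenius is onto F, a·X^{pk} = (c·X^k)^p has the same local traces as c·X^k. Iterating
lowers the exponent until it is prime to p or zero; the constant term is unconstrained in the
family. -/
theorem exists_reduced_monomial (j : ℕ) (a : F) :
    ∃ i ≤ j, ∃ b : F, (∀ k, 1 ≤ k → (monomial i b).coeff (p * k) = 0) ∧
      ∀ P : F[X], Irreducible P → localTrace p P (monomial i b) = localTrace p P (monomial j a) := by
  have hp : p.Prime := Fact.out
  have : CharP F p := charP_of_injective_algebraMap (algebraMap (ZMod p) F).injective p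
  have : ExpChar F p := ExpChar.prime hp
  induction j using Nat.strong_induction_on generalizing a with
  | _ j ih =>
    by_cases h : ∃ k, 1 ≤ k ∧ j = p * k
    · obtain ⟨k, hk, rfl⟩ := h
      have hlt : k < p * k := by nlinarith [hp.two_le]
      obtain ⟨c, rfl⟩ := surjective_frobenius F p a
      obtain ⟨i, hi, b, hb, hP⟩ := ih k hlt c
      refine ⟨i, hi.trans hlt.le, b, hb, fun P hirr => ?_⟩
      rw [hP P hirr, ← localTrace_pow p P _ hirr, monomial_pow, frobenius_def, mul_comm k p]
    · refine ⟨j, le_rfl, a, fun k hk => ?_, fun _ _ => rfl⟩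
      rw [coeff_monomial, if_neg]
      exact fun e => h ⟨k, hk, e⟩

theorem exists_reduced (d : ℕ) (g : F[X]) (hg : g.degree < d) :
    ∃ g' : F[X], g'.degree < d ∧ (∀ k, 1 ≤ k → g'.coeff (p * k) = 0) ∧
      ∀ P : F[X], Irreducible P → localTrace p P g' = localTrace p P g := by
  classical
  choose i hi b hb hP using exists_reduced_monomial p (F := F)
  have hsum : ∀ (P : F[X]) (s : Finset ℕ) (u : ℕ → F[X]),
      localTrace p P (∑ j ∈ s, u j) = ∑ j ∈ s, localTrace p P (u j) := by
    intro P s u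
    simp [localTrace]
  refine ⟨∑ j ∈ g.support, monomial (i j (g.coeff j)) (b j (g.coeff j)), ?_, ?_, ?_⟩
  · rw [← mem_degreeLT]
    refine Submodule.sum_mem _ fun j hj => mem_degreeLT.2 ?_
    refine (degree_monomial_le _ _).trans_lt ?_
    have h1 : (j : WithBot ℕ) ≤ g.degree := le_degree_of_mem_supp j hj
    have h2 : ((i j (g.coeff j) : ℕ) : WithBot ℕ) ≤ (j : WithBot ℕ) := by
      exact_mod_cast hi j _
    exact h2.trans_lt (h1.trans_lt hg)
  · intro k hk
    rw [finsetSum_coeff]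
    exact Finset.sum_eq_zero fun j _ => hb j _ k hk
  · intro P hirr
    rw [hsum, Finset.sum_congr rfl fun j _ => hP j _ P hirr, ← hsum, ← as_sum_support]

/-- Choose residues with the required traces, solve the congruences by the Chinese remainder
theorem, and reduce modulo the product of the points. The remainder has degree less than d, and
`exists_reduced` moves it into the space of admissible translations. -/
theorem exists_localTrace_eq (d : ℕ) (S : Finset F[X])
    (hS : ∀ P ∈ S, P.Monic ∧ Irreducible P) (hdeg : ∑ P ∈ S, P.natDegree < d)
    (z : F[X] → ZMod p) :
    ∃ g : F[X], g.degree < d ∧ (∀ k, 1 ≤ k → g.coeff (p * k) = 0) ∧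
      ∀ P ∈ S, localTrace p P g = z P := by
  classical
  choose! u hu using fun P : F[X] => fun h : Irreducible P => exists_trace_eq p P h (z P)
  obtain ⟨g₀, hg₀⟩ : ∃ g₀ : F[X], ∀ P ∈ S, P ∣ g₀ - u P := by
    have h := IsDedekindDomain.exists_forall_sub_mem_ideal (s := S)
      (fun P : F[X] => Ideal.span {P}) (fun _ => 1)
      (fun P hP => Ideal.prime_of_isPrime
        (by rw [Ne, Ideal.span_singleton_eq_bot]; exact (hS P hP).2.ne_zero)
        ((Ideal.span_singleton_prime (hS P hP).2.ne_zero).2 (hS P hP).2.prime))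
      (fun P hP Q hQ hne h => hne (by
        rw [Ideal.span_singleton_eq_span_singleton] at h
        exact eq_of_monic_of_associated (hS P hP).1 (hS Q hQ).1 h)) (fun P => u P)
    obtain ⟨y, hy⟩ := h
    refine ⟨y, fun P hP => ?_⟩
    have := hy P hP
    rwa [pow_one, Ideal.mem_span_singleton] at this
  have hM : (∏ P ∈ S, P).Monic := monic_prod_of_monic _ _ fun P hP => (hS P hP).1
  have hlt : (g₀ %ₘ ∏ P ∈ S, P).degree < d := by
    refine (degree_modByMonic_lt _ hM).trans_le ?_
    rw [degree_eq_natDegree hM.ne_zero, natDegree_prod_of_monic _ _ fun P hP => (hS P hP).1]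
    exact_mod_cast hdeg.le
  obtain ⟨g, h1, h2, h3⟩ := exists_reduced p d _ hlt
  refine ⟨g, h1, h2, fun P hP => ?_⟩
  have hirr := (hS P hP).2
  rw [h3 P hirr, ← hu P hirr]
  unfold localTrace
  congr 1
  rw [AdjoinRoot.mk_eq_mk]
  have hd : P ∣ g₀ %ₘ (∏ P ∈ S, P) - g₀ := by
    rw [modByMonic_eq_sub_mul_div, sub_sub_cancel_left, dvd_neg]
    exact (Finset.dvd_prod_of_mem _ hP).mul_right _
  have := dvd_add hd (hg₀ P hP)
  rwa [sub_add_sub_cancel] at this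

theorem sum_family_add (p : ℕ) {F : Type*} [Field F] [Finite F] (d : ℕ) (hd : d ≠ 0) {g : F[X]}
    (hg : g.degree < d) (hg' : ∀ k, 1 ≤ k → g.coeff (p * k) = 0) (Φ : F[X] → ℂ) :
    ∑ f ∈ (family_finite F p d).toFinset, Φ (f + g) =
      ∑ f ∈ (family_finite F p d).toFinset, Φ f := by
  refine Finset.sum_bij' (fun f _ => f + g) (fun f _ => f - g) ?_ ?_ ?_ ?_ ?_
  · intro f hf
    rw [Set.Finite.mem_toFinset] at hf ⊢
    exact add_mem_family p d hd hf hg hg'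
  · intro f hf
    rw [Set.Finite.mem_toFinset] at hf ⊢
    rw [sub_eq_add_neg]
    exact add_mem_family p d hd hf (by rwa [degree_neg]) fun k hk => by
      rw [coeff_neg, hg' k hk, neg_zero]
  · intros; ring
  · intros; ring
  · intros; rfl

/-- The local traces at a tuple of closed points of total degree less than `d` behave like
independent uniform variables. -/
theorem average_prod_localTrace [DecidableEq F[X]] (d : ℕ) (hd : d ≠ 0) (hpd : ¬ p ∣ d) (I : Finset F[X])
    (hI : ∀ P ∈ I, P.Monic ∧ Irreducible P) (n : ℕ) (t : Fin n → I)
    (hdeg : ∑ i, (t i : F[X]).natDegree < d) (Y : F[X] → ZMod p → ℂ) :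
    average F p d (fun f => ∏ i, Y (t i) (localTrace p (t i) f)) =
      (∑ z : I → ZMod p, ∏ i, Y (t i) (z (t i))) / (p : ℂ) ^ I.card := by
  have key : ∀ z : I → ZMod p,
      ∑ f ∈ (family_finite F p d).toFinset, ∏ i, Y (t i) (localTrace p (t i) f) =
      ∑ f ∈ (family_finite F p d).toFinset,
        ∏ i, Y (t i) (localTrace p (t i) f + z (t i)) := by
    intro z
    obtain ⟨g, hg, hg', hgz⟩ := exists_localTrace_eq p d
      (Finset.univ.image fun i => (t i : F[X]))
      (by
        intro P hP
        obtain ⟨i, -, rfl⟩ := Finset.mem_image.1 hP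
        exact hI _ (t i).2)
      (lt_of_le_of_lt (by
        -- A tuple may repeat points; passing to its image can only lower the total degree.
        have := Finset.sum_image_le_of_nonneg (s := Finset.univ) (g := fun i => (t i : F[X]))
          (f := fun P => P.natDegree) (by simp)
        exact this) hdeg)
      (fun P => if h : P ∈ I then z ⟨P, h⟩ else 0)
    rw [← sum_family_add p d hd hg hg']
    refine Finset.sum_congr rfl fun f _ => Finset.prod_congr rfl fun i _ => ?_
    rw [localTrace_add, hgz _ (Finset.mem_image_of_mem _ (Finset.mem_univ i)),
      dif_pos (t i).2]
  -- Averaging the identity `key` over all shifts z removes f: for fixed f, the traces of f only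
  -- translate the summation variable.
  have hz : ∀ f : F[X], ∑ z : I → ZMod p, ∏ i, Y (t i) (localTrace p (t i) f + z (t i)) =
      ∑ z : I → ZMod p, ∏ i, Y (t i) (z (t i)) := by
    intro f
    exact Fintype.sum_equiv (Equiv.addLeft fun P : I => localTrace p (P : F[X]) f) _ _
      fun z => rfl
  have hsum := Finset.sum_congr rfl fun (z : I → ZMod p) (_ : z ∈ Finset.univ) => key z
  rw [Finset.sum_const, Finset.sum_comm, Finset.sum_congr rfl fun f _ => hz f,
    Finset.sum_const, Finset.card_univ, Fintype.card_fun, ZMod.card, Fintype.card_coe] at hsum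
  have hc : ((family F p d).ncard : ℂ) ≠ 0 := by
    have := (Set.ncard_pos (family_finite F p d)).2 (family_nonempty p d hd hpd)
    exact_mod_cast this.ne'
  have hp0 : ((p : ℂ) ^ I.card) ≠ 0 :=
    pow_ne_zero _ (by exact_mod_cast (Fact.out : p.Prime).ne_zero)
  rw [average, div_eq_div_iff hc hp0]
  rw [← Set.ncard_eq_toFinset_card _ (family_finite F p d)] at hsum
  simp only [nsmul_eq_mul] at hsum
  push_cast at hsum
  linear_combination hsum

/-- Moments of a sum of local contributions are those of a sum of independent variables. -/
theorem average_sum_pow [DecidableEq F[X]] (d : ℕ) (hd : d ≠ 0) (hpd : ¬ p ∣ d) (I : Finset F[X])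
    (hI : ∀ P ∈ I, P.Monic ∧ Irreducible P) (n K : ℕ) (hK : ∀ P ∈ I, P.natDegree ≤ K)
    (hn : n * K < d) (Y : F[X] → ZMod p → ℂ) :
    average F p d (fun f => (∑ P ∈ I, Y P (localTrace p P f)) ^ n) =
      (∑ z : I → ZMod p, (∑ P : I, Y P (z P)) ^ n) / (p : ℂ) ^ I.card := by
  have hpow : ∀ w : I → ℂ, (∑ P : I, w P) ^ n = ∑ t : Fin n → I, ∏ i, w (t i) := by
    intro w
    have := Finset.prod_univ_sum (fun _ : Fin n => (Finset.univ : Finset I)) (fun _ P => w P)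
    rw [Fintype.piFinset_univ, Finset.prod_const, Finset.card_univ, Fintype.card_fin] at this
    exact this
  have h1 : ∀ f : F[X], (∑ P ∈ I, Y P (localTrace p P f)) ^ n
      = ∑ t : Fin n → I, ∏ i, Y (t i) (localTrace p (t i) f) := by
    intro f
    rw [← hpow fun P : I => Y P (localTrace p (P : F[X]) f),
      Finset.sum_coe_sort I fun P => Y P (localTrace p P f)]
  have h2 : ∀ z : I → ZMod p, (∑ P : I, Y P (z P)) ^ n
      = ∑ t : Fin n → I, ∏ i, Y (t i) (z (t i)) := fun z => hpow fun P => Y P (z P)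
  have h3 : ∑ z : I → ZMod p, (∑ P : I, Y P (z P)) ^ n
      = ∑ t : Fin n → I, ∑ z : I → ZMod p, ∏ i, Y (t i) (z (t i)) := by
    rw [Finset.sum_congr rfl fun z _ => h2 z]
    exact Finset.sum_comm
  have h4 : ∑ f ∈ (family_finite F p d).toFinset, (∑ P ∈ I, Y P (localTrace p P f)) ^ n
      = ∑ t : Fin n → I, ∑ f ∈ (family_finite F p d).toFinset,
        ∏ i, Y (t i) (localTrace p (t i) f) := by
    rw [Finset.sum_congr rfl fun f _ => h1 f]
    exact Finset.sum_comm
  rw [average, h3, h4, Finset.sum_div, Finset.sum_div]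
  refine Finset.sum_congr rfl fun t _ => ?_
  refine average_prod_localTrace p d hd hpd I hI n t ?_ Y
  calc ∑ i, (t i : F[X]).natDegree ≤ ∑ _i : Fin n, K :=
        Finset.sum_le_sum fun i _ => hK _ (t i).2
    _ = n * K := by simp
    _ < d := hn

end Equidistribution

end ClosedPoints

/-! ### Moment series and their logarithmic derivatives -/

section MomentSeries

open PowerSeries

/-- The exponential generating function of the moments of `v x` for `x` uniform in `Z`. -/
def momentSeries {Z : Type*} [Fintype Z] (v : Z → ℂ) : ℂ⟦X⟧ :=
  C (Fintype.card Z : ℂ)⁻¹ * ∑ x, rescale (v x) (PowerSeries.exp ℂ)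

theorem coeff_rescale_exp (a : ℂ) (n : ℕ) :
    coeff n (rescale a (PowerSeries.exp ℂ)) = a ^ n / (n.factorial : ℂ) := by
  simp [coeff_rescale, PowerSeries.coeff_exp, div_eq_mul_inv]

theorem coeff_momentSeries {Z : Type*} [Fintype Z] (v : Z → ℂ) (n : ℕ) :
    coeff n (momentSeries v) = (∑ x, v x ^ n) / Fintype.card Z / (n.factorial : ℂ) := by
  rw [momentSeries, coeff_C_mul, map_sum, Finset.sum_congr rfl fun x _ => coeff_rescale_exp _ n,
    ← Finset.sum_div]
  ring

theorem prod_rescale_exp {ι : Type*} (s : Finset ι) (a : ι → ℂ) :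
    ∏ i ∈ s, rescale (a i) (PowerSeries.exp ℂ) = rescale (∑ i ∈ s, a i) (PowerSeries.exp ℂ) := by
  classical
  induction s using Finset.induction_on with
  | empty =>
    ext n
    rw [Finset.prod_empty, Finset.sum_empty, coeff_rescale_exp, coeff_one]
    rcases n with _ | n <;> simp
  | insert i s hi ih =>
    rw [Finset.prod_insert hi, Finset.sum_insert hi, ih, PowerSeries.exp_mul_exp_eq_exp_add]

/-- Independence in generating-function form: the exponential of a sum is the product of the
exponentials, and the uniform average over a product space factors. -/
theorem moment_sum_eq {ι Z : Type*} [Fintype ι] [DecidableEq ι] [Fintype Z] (v : ι → Z → ℂ)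
    (n : ℕ) :
    (∑ z : ι → Z, (∑ i, v i (z i)) ^ n) / (Fintype.card Z : ℂ) ^ Fintype.card ι
      = (n.factorial : ℂ) * coeff n (∏ i, momentSeries (v i)) := by
  have h1 : ∏ i, momentSeries (v i) = C ((Fintype.card Z : ℂ)⁻¹ ^ Fintype.card ι) *
      ∑ z : ι → Z, rescale (∑ i, v i (z i)) (PowerSeries.exp ℂ) := by
    simp only [momentSeries]
    rw [Finset.prod_mul_distrib, Finset.prod_const, Finset.card_univ, ← map_pow,
      Finset.prod_univ_sum, Fintype.piFinset_univ]
    simp_rw [prod_rescale_exp]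
  rw [h1, coeff_C_mul, map_sum, Finset.sum_congr rfl fun z _ => coeff_rescale_exp _ n,
    ← Finset.sum_div]
  have : (n.factorial : ℂ) ≠ 0 := by exact_mod_cast n.factorial_ne_zero
  rw [inv_pow]
  field_simp

/-- The logarithmic derivative of a power series. -/
def logDerivSeries (M : ℂ⟦X⟧) : ℂ⟦X⟧ := d⁄dX ℂ M * M⁻¹

theorem logDerivSeries_mul {M : ℂ⟦X⟧} (hM : constantCoeff M ≠ 0) :
    logDerivSeries M * M = d⁄dX ℂ M := by
  rw [logDerivSeries, mul_assoc, PowerSeries.inv_mul_cancel M hM, mul_one]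

theorem logDerivSeries_prod {ι : Type*} (s : Finset ι) (M : ι → ℂ⟦X⟧)
    (hM : ∀ i ∈ s, constantCoeff (M i) ≠ 0) :
    logDerivSeries (∏ i ∈ s, M i) = ∑ i ∈ s, logDerivSeries (M i) := by
  classical
  induction s using Finset.induction_on with
  | empty => simp [logDerivSeries]
  | insert i s hi ih =>
    have h1 := hM i (Finset.mem_insert_self i s)
    have h2 : constantCoeff (∏ i ∈ s, M i) ≠ 0 := by
      rw [map_prod]
      exact Finset.prod_ne_zero_iff.2 fun j hj => hM j (Finset.mem_insert_of_mem hj)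
    rw [Finset.prod_insert hi, Finset.sum_insert hi,
      ← ih fun j hj => hM j (Finset.mem_insert_of_mem hj)]
    have h3 : constantCoeff (M i * ∏ i ∈ s, M i) ≠ 0 := by
      rw [map_mul]; exact mul_ne_zero h1 h2
    have h4 : M i * ∏ i ∈ s, M i ≠ 0 := fun h => h3 (by rw [h, map_zero])
    refine mul_right_cancel₀ h4 ?_
    rw [logDerivSeries_mul h3, Derivation.leibniz, ← logDerivSeries_mul h1,
      ← logDerivSeries_mul h2, smul_eq_mul, smul_eq_mul]
    ring

/-- Comparison of coefficients in M' = (M'/M)·M. This recursion is the only link between cumulants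
and moments used below. -/
theorem succ_mul_coeff_succ {M : ℂ⟦X⟧} (hM : constantCoeff M = 1) (n : ℕ) :
    ((n : ℂ) + 1) * coeff (n + 1) M =
      ∑ i ∈ Finset.range (n + 1), coeff i (logDerivSeries M) * coeff (n - i) M := by
  have h := congrArg (coeff n) (logDerivSeries_mul (M := M) (by rw [hM]; exact one_ne_zero))
  rw [coeff_derivative, coeff_mul, Finset.Nat.sum_antidiagonal_eq_sum_range_succ_mk] at h
  rw [h, mul_comm]

theorem coeff_zero_logDerivSeries {M : ℂ⟦X⟧} (hM : constantCoeff M = 1) :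
    coeff 0 (logDerivSeries M) = coeff 1 M := by
  have h := succ_mul_coeff_succ hM 0
  simp [hM] at h
  rw [h, coeff_zero_eq_constantCoeff_apply]

theorem coeff_one_logDerivSeries {M : ℂ⟦X⟧} (hM : constantCoeff M = 1) :
    coeff 1 (logDerivSeries M) = 2 * coeff 2 M - coeff 1 M ^ 2 := by
  have h := succ_mul_coeff_succ hM 1
  rw [Finset.sum_range_succ, Finset.sum_range_one, coeff_zero_logDerivSeries hM] at h
  simp only [Nat.cast_one, Nat.sub_zero, Nat.sub_self, coeff_zero_eq_constantCoeff_apply, hM] at h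
  linear_combination -h

/-- By the recursion, the coefficient of order n is a universal polynomial in the coefficients of M,
homogeneous of weight n + 1, so it scales like B^{n+1} with a constant depending on n alone. -/
theorem exists_norm_coeff_logDerivSeries_le (n : ℕ) :
    ∃ c : ℝ, 0 ≤ c ∧ ∀ (M : ℂ⟦X⟧) (B : ℝ), constantCoeff M = 1 → 0 ≤ B →
      (∀ k, ‖coeff k M‖ ≤ B ^ k) → ‖coeff n (logDerivSeries M)‖ ≤ c * B ^ (n + 1) := by
  induction n using Nat.strong_induction_on with
  | _ n ih =>
    choose! c hc0 hc using ih
    refine ⟨(n + 1) + ∑ i ∈ Finset.range n, c i, add_nonneg (by positivity)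
      (Finset.sum_nonneg fun i hi => hc0 i (Finset.mem_range.1 hi)), fun M B hM hB hk => ?_⟩
    have h := succ_mul_coeff_succ hM n
    rw [Finset.sum_range_succ, Nat.sub_self, coeff_zero_eq_constantCoeff_apply, hM, mul_one] at h
    have h' : coeff n (logDerivSeries M) = ((n : ℂ) + 1) * coeff (n + 1) M -
        ∑ i ∈ Finset.range n, coeff i (logDerivSeries M) * coeff (n - i) M := by
      linear_combination -h
    rw [h', add_mul _ _ (B ^ (n + 1)), Finset.sum_mul]
    refine (norm_sub_le _ _).trans (add_le_add ?_ ((norm_sum_le _ _).trans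
      (Finset.sum_le_sum fun i hi => ?_)))
    · rw [norm_mul]
      have : ‖(n : ℂ) + 1‖ = n + 1 := by
        rw [← Nat.cast_add_one, Complex.norm_natCast]; push_cast; rfl
      rw [this]
      exact mul_le_mul_of_nonneg_left (hk _) (by positivity)
    · have hi' := Finset.mem_range.1 hi
      rw [norm_mul]
      calc _ ≤ (c i * B ^ (i + 1)) * B ^ (n - i) :=
            mul_le_mul (hc i hi' M B hM hB hk) (hk _) (norm_nonneg _)
              (mul_nonneg (hc0 i hi') (pow_nonneg hB _))
        _ = c i * B ^ (n + 1) := by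
            rw [mul_assoc, ← pow_add]; congr 2; omega

theorem constantCoeff_momentSeries {Z : Type*} [Fintype Z] [Nonempty Z] (v : Z → ℂ) :
    constantCoeff (momentSeries v) = 1 := by
  rw [← coeff_zero_eq_constantCoeff_apply, coeff_momentSeries]
  simp

theorem norm_coeff_momentSeries_le {Z : Type*} [Fintype Z] [Nonempty Z] (v : Z → ℂ) {B : ℝ}
    (hv : ∀ x, ‖v x‖ ≤ B) (n : ℕ) : ‖coeff n (momentSeries v)‖ ≤ B ^ n := by
  have hB : 0 ≤ B := (norm_nonneg _).trans (hv (Classical.arbitrary Z))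
  have hZ : (0 : ℝ) < Fintype.card Z := by exact_mod_cast Fintype.card_pos
  rw [coeff_momentSeries, norm_div, norm_div, Complex.norm_natCast, Complex.norm_natCast]
  have h1 : ‖∑ x, v x ^ n‖ / Fintype.card Z ≤ B ^ n := by
    rw [div_le_iff₀ hZ]
    calc ‖∑ x, v x ^ n‖ ≤ ∑ _x : Z, B ^ n := (norm_sum_le _ _).trans
          (Finset.sum_le_sum fun x _ => by
            rw [norm_pow]; exact pow_le_pow_left₀ (norm_nonneg _) (hv x) n)
      _ = B ^ n * Fintype.card Z := by
          rw [Finset.sum_const, Finset.card_univ, nsmul_eq_mul, mul_comm]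
  refine (div_le_self (div_nonneg (norm_nonneg _) hZ.le) ?_).trans h1
  exact_mod_cast n.factorial_pos

end MomentSeries

/-! ### From cumulants to Gaussian moments -/

section MomentAsymptotics

open Asymptotics Filter

variable {Ω : Type*}

theorem isBigO_of_eq {E : Type*} [Norm E] {f g : Ω → E} {u : Filter Ω} (h : ∀ x, f x = g x) :
    f =O[u] g := by
  rw [funext h]

/-- Bounds for moments from bounds for cumulants; `b` bounds those of odd order. -/
theorem moment_isBigO (l μ : ℕ → Ω → ℂ) (b L : Ω → ℝ)
    (h0 : ∀ x, μ 0 x = 1)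
    (hrec : ∀ (n : ℕ) x, ((n : ℂ) + 1) * μ (n + 1) x = ∑ i ∈ Finset.range (n + 1), l i x * μ (n - i) x)
    (hl0 : l 0 =O[⊤] b) (hl1 : l 1 =O[⊤] L) (hl : ∀ i, 2 ≤ i → l i =O[⊤] b)
    (hb : b =O[⊤] fun _ => (1 : ℝ)) (hL : (fun _ => (1 : ℝ)) =O[⊤] L) (n : ℕ) :
    μ n =O[⊤] fun x => b x ^ (n % 2) * L x ^ (n / 2) := by
  have hLpow : ∀ {i j : ℕ}, i ≤ j → (fun x => L x ^ i) =O[⊤] fun x => L x ^ j := by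
    intro i j hij
    have := (isBigO_refl (fun x => L x ^ i) ⊤).mul (hL.pow (j - i))
    simp only [one_pow, mul_one, ← pow_add] at this
    rwa [Nat.add_sub_cancel' hij] at this
  have hbpow : ∀ {i j : ℕ}, j ≤ i → (fun x => b x ^ i) =O[⊤] fun x => b x ^ j := by
    intro i j hij
    have := (isBigO_refl (fun x => b x ^ j) ⊤).mul (hb.pow (i - j))
    simp only [one_pow, mul_one, ← pow_add] at this
    rwa [Nat.add_sub_cancel' hij] at this
  induction n using Nat.strong_induction_on with
  | _ n ih =>
    rcases n with _ | n
    · simpa [funext h0] using isBigO_refl (fun _ : Ω => (1 : ℝ)) ⊤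
    · have hn : ((n : ℂ) + 1) ≠ 0 := by exact_mod_cast n.succ_ne_zero
      have hμ : μ (n + 1) = fun x => ((n : ℂ) + 1)⁻¹ *
          ∑ i ∈ Finset.range (n + 1), l i x * μ (n - i) x := by
        funext x
        rw [← hrec n x, inv_mul_cancel_left₀ hn]
      rw [hμ]
      refine IsBigO.const_mul_left (IsBigO.fun_sum fun i hi => ?_) _
      have hi' : i ≤ n := Nat.lt_succ_iff.1 (Finset.mem_range.1 hi)
      have hstep := ih (n - i) (by omega)
      -- Only the variance (i = 1) gains a factor `L`, and it uses up two orders without changing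
      -- the parity. Every other cumulant brings a factor `b`, which pays for a possible change from
      -- even to odd.
      rcases Nat.eq_zero_or_pos i with rfl | hipos
      · have := hl0.mul hstep
        refine this.trans ?_
        simp only [Nat.sub_zero, ← mul_assoc, ← pow_succ']
        exact (hbpow (by omega)).mul (hLpow (by omega))
      rcases Nat.eq_or_lt_of_le (Nat.succ_le_of_lt hipos) with rfl | hi2
      · have := hl1.mul hstep
        refine this.trans ?_
        have e : (fun x => L x * (b x ^ ((n - 1) % 2) * L x ^ ((n - 1) / 2)))
            = fun x => b x ^ ((n - 1) % 2) * L x ^ ((n - 1) / 2 + 1) := by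
          funext x; ring
        rw [show Nat.succ 0 = 1 from rfl, e]
        exact (hbpow (by omega)).mul (hLpow (by omega))
      · have := (hl i hi2).mul hstep
        refine this.trans ?_
        simp only [← mul_assoc, ← pow_succ']
        exact (hbpow (by omega)).mul (hLpow (by omega))

/-- Gaussian asymptotics of moments: the second cumulant is `2τ`, up to a bounded error, and the
expectation is `c`. -/
theorem moment_asymptotics (l μ : ℕ → Ω → ℂ) (b L : Ω → ℝ) (τ c : Ω → ℂ)
    (h0 : ∀ x, μ 0 x = 1)
    (hrec : ∀ (n : ℕ) x, ((n : ℂ) + 1) * μ (n + 1) x = ∑ i ∈ Finset.range (n + 1), l i x * μ (n - i) x)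
    (hl0 : (fun x => (l 0 x - c x) * L x) =O[⊤] b) (hc : c =O[⊤] b)
    (hl1 : (fun x => l 1 x - 2 * τ x) =O[⊤] fun _ => (1 : ℝ)) (hτ : τ =O[⊤] L)
    (hl : ∀ i, 2 ≤ i → l i =O[⊤] b)
    (hb : b =O[⊤] fun _ => (1 : ℝ)) (hL : ∀ x, 1 ≤ L x) (n : ℕ) :
    (fun x => (μ (2 * n) x - τ x ^ n / n.factorial) * L x) =O[⊤] (fun x => L x ^ n) ∧
    (fun x => (μ (2 * n + 1) x - c x * (τ x ^ n / n.factorial)) * L x)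
      =O[⊤] (fun x => b x * L x ^ n) := by
  have hL1 : (fun _ => (1 : ℝ)) =O[⊤] L := by
    refine IsBigO.of_bound 1 (Eventually.of_forall fun x => ?_)
    rw [norm_one, one_mul]
    exact (hL x).trans (le_abs_self _)
  have hLpow : ∀ {i j : ℕ}, i ≤ j → (fun x => L x ^ i) =O[⊤] fun x => L x ^ j := by
    intro i j hij
    have := (isBigO_refl (fun x => L x ^ i) ⊤).mul (hL1.pow (j - i))
    simp only [one_pow, mul_one, ← pow_add] at this
    rwa [Nat.add_sub_cancel' hij] at this
  have hLC : (fun x => (L x : ℂ)) =O[⊤] L :=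
    IsBigO.of_bound 1 (Eventually.of_forall fun x => by simp)
  -- Errors carry an extra factor `L` on the left so that order n - 1 makes sense at n = 0 without
  -- negative powers; as `L` is at least 1, that factor may be dropped.
  have hl0' : (fun x => l 0 x - c x) =O[⊤] b := by
    refine IsBigO.trans (IsBigO.of_bound 1 (Eventually.of_forall fun x => ?_)) hl0
    rw [one_mul, norm_mul]
    refine le_mul_of_one_le_right (norm_nonneg _) ?_
    rw [Complex.norm_real]
    exact (hL x).trans (le_abs_self _)
  have hl0b : l 0 =O[⊤] b := by
    have := hl0'.add hc
    simpa using this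
  have hl1L : l 1 =O[⊤] L := by
    have := (hl1.trans hL1).add (hτ.const_mul_left 2)
    simpa using this
  have size := moment_isBigO l μ b L h0 hrec hl0b hl1L hl hb hL1
  have size0 : ∀ n, μ (2 * n) =O[⊤] fun x => L x ^ n := fun n => by
    have := size (2 * n)
    rw [show 2 * n % 2 = 0 by omega, show 2 * n / 2 = n by omega] at this
    simpa using this
  have size1 : ∀ n, μ (2 * n + 1) =O[⊤] fun x => b x * L x ^ n := fun n => by
    have := size (2 * n + 1)
    rw [show (2 * n + 1) % 2 = 1 by omega, show (2 * n + 1) / 2 = n by omega] at this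
    simpa using this
  -- contribution of the cumulants of order at least three
  have tail0 : ∀ n, (fun x => (∑ i ∈ Finset.range (2 * n), l (i + 2) x * μ (2 * n - 1 - i) x)
      * L x) =O[⊤] fun x => L x ^ (n + 1) := by
    intro n
    simp_rw [Finset.sum_mul]
    refine IsBigO.fun_sum fun i hi => ?_
    have hi := Finset.mem_range.1 hi
    have := (((hl (i + 2) (by omega)).trans hb).mul (size (2 * n - 1 - i))).mul hLC
    refine this.trans ?_
    have h2 := (hb.pow ((2 * n - 1 - i) % 2)).mul
      (hLpow (i := (2 * n - 1 - i) / 2 + 1) (j := n + 1) (by omega))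
    simp only [one_pow, one_mul] at h2 ⊢
    refine IsBigO.trans (isBigO_of_eq fun x => by ring) h2
  have tail1 : ∀ n, (fun x => (∑ i ∈ Finset.range (2 * n + 1), l (i + 2) x * μ (2 * n - i) x)
      * L x) =O[⊤] fun x => b x * L x ^ (n + 1) := by
    intro n
    simp_rw [Finset.sum_mul]
    refine IsBigO.fun_sum fun i hi => ?_
    have hi := Finset.mem_range.1 hi
    have := ((hl (i + 2) (by omega)).mul (size (2 * n - i))).mul hLC
    refine this.trans ?_
    have h2 := ((isBigO_refl b ⊤).mul (hb.pow ((2 * n - i) % 2))).mul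
      (hLpow (i := (2 * n - i) / 2 + 1) (j := n + 1) (by omega))
    simp only [one_pow, mul_one] at h2
    refine IsBigO.trans (isBigO_of_eq fun x => by ring) h2
  -- In the recursion for the moment of order 2n + 1, the mean multiplies the even moment of order
  -- 2n and contributes c·τ^n/n!. The variance contributes 2n times this amount, which accounts for
  -- the factor 2n + 1 on the left.
  have odd_of_even : ∀ n, (fun x => (μ (2 * n) x - τ x ^ n / n.factorial) * L x)
        =O[⊤] (fun x => L x ^ n) →
      (fun x => ((2 * n + 1 : ℂ) * μ (2 * n + 1) x - ∑ i ∈ Finset.range (2 * n), l (i + 1) x *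
        μ (2 * n - (i + 1)) x - c x * (τ x ^ n / n.factorial)) * L x)
        =O[⊤] (fun x => b x * L x ^ n) := by
    intro n he
    have h1 := hl0.mul (size0 n)
    have h2 := hc.mul he
    refine (h1.add h2).congr_left fun x => ?_
    have h := hrec (2 * n) x
    rw [Finset.sum_range_succ'] at h
    push_cast at h
    rw [h]
    simp only [Nat.sub_zero]
    ring
  have fac : ∀ n : ℕ, ((n + 1).factorial : ℂ) = (n + 1) * n.factorial := by
    intro n; rw [Nat.factorial_succ]; push_cast; ring
  have fne : ∀ n : ℕ, (n.factorial : ℂ) ≠ 0 := fun n => by exact_mod_cast n.factorial_ne_zero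
  have nne : ∀ n : ℕ, (n : ℂ) + 1 ≠ 0 := fun n => by exact_mod_cast n.succ_ne_zero
  induction n with
  | zero =>
    have he : (fun x => (μ (2 * 0) x - τ x ^ 0 / (Nat.factorial 0 : ℂ)) * L x)
        =O[⊤] (fun x => L x ^ 0) := by
      exact (isBigO_zero (E' := ℂ) (fun x => L x ^ 0) ⊤).congr_left fun x => by simp [h0]
    refine ⟨he, ?_⟩
    have := odd_of_even 0 he
    simpa using this
  | succ n ih =>
    obtain ⟨ihe, iho⟩ := ih
    have he : (fun x => (μ (2 * (n + 1)) x - τ x ^ (n + 1) / ((n + 1).factorial : ℂ)) * L x)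
        =O[⊤] (fun x => L x ^ (n + 1)) := by
      -- the recursion at order `2n + 2`
      have t0 : (fun x => l 0 x * μ (2 * n + 1) x * L x) =O[⊤] fun x => L x ^ (n + 1) := by
        refine ((hl0b.mul (size1 n)).mul hLC).trans ?_
        have h2 := (hb.mul hb).mul (hLpow (le_refl (n + 1)))
        simp only [one_mul] at h2
        refine IsBigO.trans (isBigO_of_eq fun x => by ring) h2
      have t1 : (fun x => (l 1 x - 2 * τ x) * μ (2 * n) x * L x) =O[⊤] fun x => L x ^ (n + 1) := by
        refine ((hl1.mul (size0 n)).mul hLC).trans (isBigO_of_eq fun x => by ring)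
      have t2 : (fun x => 2 * τ x * ((μ (2 * n) x - τ x ^ n / n.factorial) * L x))
          =O[⊤] fun x => L x ^ (n + 1) := by
        refine ((hτ.const_mul_left 2).mul ihe).trans (isBigO_of_eq fun x => by ring)
      have := (((t0.add t1).add t2).add (tail0 n)).const_mul_left (2 * ((n : ℂ) + 1))⁻¹
      refine this.congr_left fun x => ?_
      have h := hrec (2 * n + 1) x
      rw [Finset.sum_range_succ', Finset.sum_range_succ'] at h
      rw [show 2 * (n + 1) = 2 * n + 1 + 1 by ring, fac, inv_mul_eq_iff_eq_mul₀
        (mul_ne_zero two_ne_zero (nne n))]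
      have e : ∀ i, 2 * n + 1 - (i + 1 + 1) = 2 * n - 1 - i := fun i => by omega
      simp only [e, Nat.sub_zero, zero_add, Nat.add_sub_cancel] at h
      push_cast at h
      have e2 : 2 * ((n : ℂ) + 1) * (τ x ^ (n + 1) / ((n + 1) * n.factorial)) =
          2 * τ x * (τ x ^ n / n.factorial) := by
        have := nne n; have := fne n
        field_simp
        ring
      linear_combination (-(L x : ℂ)) * h + (L x : ℂ) * e2
    refine ⟨he, ?_⟩
    have hodd := odd_of_even (n + 1) he
    have t1 : (fun x => (l 1 x - 2 * τ x) * μ (2 * n + 1) x * L x)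
        =O[⊤] fun x => b x * L x ^ (n + 1) := by
      refine ((hl1.mul (size1 n)).mul hLC).trans (isBigO_of_eq fun x => by ring)
    have t2 : (fun x => 2 * τ x * ((μ (2 * n + 1) x - c x * (τ x ^ n / n.factorial)) * L x))
        =O[⊤] fun x => b x * L x ^ (n + 1) := by
      refine ((hτ.const_mul_left 2).mul iho).trans (isBigO_of_eq fun x => by ring)
    have hne : (2 * ((n : ℂ) + 1) + 1) ≠ 0 := by exact_mod_cast Nat.succ_ne_zero (2 * (n + 1))
    have := (((hodd.add t1).add t2).add (tail1 n)).const_mul_left (2 * ((n : ℂ) + 1) + 1)⁻¹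
    refine this.congr_left fun x => ?_
    rw [inv_mul_eq_iff_eq_mul₀ hne, show 2 * (n + 1) = 2 * n + 1 + 1 by ring,
      Finset.sum_range_succ']
    have e : ∀ i, 2 * n + 1 + 1 - (i + 1 + 1) = 2 * n - i := fun i => by omega
    simp only [e, zero_add, Nat.add_sub_cancel, fac]
    have e2 : 2 * ((n : ℂ) + 1) * (τ x ^ (n + 1) / ((n + 1) * n.factorial)) =
        2 * τ x * (τ x ^ n / n.factorial) := by
      have := nne n; have := fne n
      field_simp
      ring
    push_cast
    linear_combination (c x * L x : ℂ) * e2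

end MomentAsymptotics

/-! ### Fourier coefficients of the Beurling-Selberg polynomials -/

section Fourier

/-- The `k`-th Fourier coefficient of the Beurling-Selberg majorant (`s = 1`) or minorant
(`s = -1`), for `1 ≤ k ≤ K`. -/
def selbergCoef (K : ℕ) (β s : ℝ) (k : ℕ) : ℝ :=
  vaalerWeight ((k : ℝ) / ((K : ℝ) + 1)) * (Real.sin (Real.pi * k * β) / (Real.pi * k)) +
    s * ((1 - (k : ℝ) / ((K : ℝ) + 1)) * Real.cos (Real.pi * k * β) / ((K : ℝ) + 1))

theorem sin_add_cos_add_aux (β x : ℝ) (k : ℕ) :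
    Real.sin (2 * Real.pi * k * (x - β / 2)) + Real.sin (2 * Real.pi * k * (-β / 2 - x)) =
      -2 * Real.sin (Real.pi * k * β) * Real.cos (2 * Real.pi * k * x) ∧
    Real.cos (2 * Real.pi * k * (x - β / 2)) + Real.cos (2 * Real.pi * k * (-β / 2 - x)) =
      2 * Real.cos (Real.pi * k * β) * Real.cos (2 * Real.pi * k * x) := by
  have e1 : 2 * Real.pi * k * (x - β / 2) = 2 * Real.pi * k * x - Real.pi * k * β := by ring
  have e2 : 2 * Real.pi * k * (-β / 2 - x) = -(2 * Real.pi * k * x + Real.pi * k * β) := by ring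
  rw [e1, e2, Real.sin_sub, Real.sin_neg, Real.sin_add, Real.cos_sub, Real.cos_neg, Real.cos_add]
  constructor <;> ring

theorem vaaler_add (K : ℕ) (β x : ℝ) :
    vaaler K (x - β / 2) + vaaler K (-β / 2 - x) = ∑ k ∈ Finset.Icc 1 K,
      2 * (vaalerWeight ((k : ℝ) / ((K : ℝ) + 1)) *
        (Real.sin (Real.pi * k * β) / (Real.pi * k))) * Real.cos (2 * Real.pi * k * x) := by
  rw [vaaler, vaaler, ← neg_add, ← Finset.sum_add_distrib, ← Finset.sum_neg_distrib]
  refine Finset.sum_congr rfl fun k _ => ?_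
  rw [← add_div, ← mul_add, (sin_add_cos_add_aux β x k).1]
  ring

theorem fejer_add (K : ℕ) (β x : ℝ) :
    fejer K (x - β / 2) / (2 * ((K : ℝ) + 1)) + fejer K (-β / 2 - x) / (2 * ((K : ℝ) + 1)) =
      1 / ((K : ℝ) + 1) + ∑ k ∈ Finset.Icc 1 K,
      2 * ((1 - (k : ℝ) / ((K : ℝ) + 1)) * Real.cos (Real.pi * k * β) / ((K : ℝ) + 1)) *
        Real.cos (2 * Real.pi * k * x) := by
  have hK : (K : ℝ) + 1 ≠ 0 := by positivity
  have : ∑ k ∈ Finset.Icc 1 K, 2 * ((1 - (k : ℝ) / ((K : ℝ) + 1)) * Real.cos (Real.pi * k * β) /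
      ((K : ℝ) + 1)) * Real.cos (2 * Real.pi * k * x) =
      (∑ k ∈ Finset.Icc 1 K, ((1 - (k : ℝ) / ((K : ℝ) + 1)) *
        Real.cos (2 * Real.pi * k * (x - β / 2))) + ∑ k ∈ Finset.Icc 1 K,
        ((1 - (k : ℝ) / ((K : ℝ) + 1)) * Real.cos (2 * Real.pi * k * (-β / 2 - x)))) /
        ((K : ℝ) + 1) := by
    rw [← Finset.sum_add_distrib, Finset.sum_div]
    refine Finset.sum_congr rfl fun k _ => ?_
    rw [← mul_add, (sin_add_cos_add_aux β x k).2]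
    ring
  rw [this, fejer, fejer]
  generalize ∑ k ∈ Finset.Icc 1 K, (1 - (k : ℝ) / ((K : ℝ) + 1)) *
    Real.cos (2 * Real.pi * k * (x - β / 2)) = A
  generalize ∑ k ∈ Finset.Icc 1 K, (1 - (k : ℝ) / ((K : ℝ) + 1)) *
    Real.cos (2 * Real.pi * k * (-β / 2 - x)) = B
  field_simp
  ring

theorem selbergMajorant_eq (K : ℕ) (β x : ℝ) :
    selbergMajorant K β x = (β + 1 / ((K : ℝ) + 1)) +
      ∑ k ∈ Finset.Icc 1 K, 2 * selbergCoef K β 1 k * Real.cos (2 * Real.pi * k * x) := by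
  have h : selbergMajorant K β x = β + (vaaler K (x - β / 2) + vaaler K (-β / 2 - x)) +
      (fejer K (x - β / 2) / (2 * ((K : ℝ) + 1)) +
        fejer K (-β / 2 - x) / (2 * ((K : ℝ) + 1))) := by
    rw [selbergMajorant, beurling, beurling]; ring
  rw [h, vaaler_add, fejer_add]
  simp only [selbergCoef, one_mul, mul_add, add_mul, Finset.sum_add_distrib]
  ring

/-- Vaaler's polynomial is odd and the Fejér kernel even, so passing from majorant to minorant only
reverses the Fejér part. The parameter s of `selbergCoef` records this sign. -/
theorem selbergMinorant_eq (K : ℕ) (β x : ℝ) :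
    selbergMinorant K β x = (β - 1 / ((K : ℝ) + 1)) +
      ∑ k ∈ Finset.Icc 1 K, 2 * selbergCoef K β (-1) k * Real.cos (2 * Real.pi * k * x) := by
  have hv : ∀ y, vaaler K (-y) = -vaaler K y := by
    intro y
    simp only [vaaler, mul_neg, Real.sin_neg, neg_div, Finset.sum_neg_distrib]
  have hf : ∀ y, fejer K (-y) = fejer K y := by
    intro y
    simp only [fejer, mul_neg, Real.cos_neg]
  have h : selbergMinorant K β x = β + (vaaler K (x - β / 2) + vaaler K (-β / 2 - x)) -
      (fejer K (x - β / 2) / (2 * ((K : ℝ) + 1)) +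
        fejer K (-β / 2 - x) / (2 * ((K : ℝ) + 1))) := by
    rw [selbergMinorant, beurling, beurling, show β / 2 - x = -(x - β / 2) by ring,
      show x + β / 2 = -(-β / 2 - x) by ring, hv, hv, hf, hf]
    ring
  rw [h, vaaler_add, fejer_add]
  simp only [selbergCoef, neg_mul, one_mul, mul_add, add_mul, Finset.sum_add_distrib, mul_neg,
    Finset.sum_neg_distrib]
  ring

theorem integral_exp_int (n : ℤ) :
    ∫ x in (-(1 / 2 : ℝ))..(1 / 2 : ℝ), Complex.exp (2 * Real.pi * Complex.I * n * (x : ℂ)) =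
      if n = 0 then 1 else 0 := by
  split_ifs with h
  · subst h
    simp
    norm_num
  · have hc : (2 * Real.pi * Complex.I * n : ℂ) ≠ 0 := by
      simp [Real.pi_ne_zero, h]
    rw [integral_exp_mul_complex hc, div_eq_zero_iff]
    left
    rw [sub_eq_zero, Complex.exp_eq_exp_iff_exists_int]
    exact ⟨n, by push_cast; ring⟩

/-- An even cosine polynomial has equal coefficients at k and -k. This is what lets ψ and its
conjugate share one real weight. -/
theorem fourierCoef_trigPoly (K : ℕ) (c₀ : ℝ) (a : ℕ → ℝ) (h : ℝ → ℝ)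
    (hh : ∀ x, h x = c₀ + ∑ k ∈ Finset.Icc 1 K, 2 * a k * Real.cos (2 * Real.pi * k * x))
    (k : ℤ) (hk : k.natAbs ∈ Finset.Icc 1 K) : fourierCoef h k = a k.natAbs := by
  have hk0 : k ≠ 0 := by
    rintro rfl
    simp at hk
  have hint : ∀ x : ℝ, (h x : ℂ) * Complex.exp (-(2 * Real.pi * Complex.I * (k : ℂ) * (x : ℂ))) =
      c₀ * Complex.exp (2 * Real.pi * Complex.I * ((-k : ℤ) : ℂ) * (x : ℂ)) +
      ∑ j ∈ Finset.Icc 1 K, (a j : ℂ) *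
        (Complex.exp (2 * Real.pi * Complex.I * ((j - k : ℤ) : ℂ) * (x : ℂ)) +
          Complex.exp (2 * Real.pi * Complex.I * ((-j - k : ℤ) : ℂ) * (x : ℂ))) := by
    intro x
    rw [hh, Complex.ofReal_add, add_mul, Complex.ofReal_sum, Finset.sum_mul]
    congr 1
    · congr 2; push_cast; ring
    · refine Finset.sum_congr rfl fun j _ => ?_
      push_cast
      rw [Complex.cos, show (2 * Real.pi * Complex.I * ((j : ℂ) - k) * x) =
        2 * Real.pi * j * x * Complex.I + -(2 * Real.pi * Complex.I * (k : ℂ) * (x : ℂ)) by ring,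
        show (2 * Real.pi * Complex.I * (-(j : ℂ) - k) * x) =
        -(2 * Real.pi * j * x) * Complex.I + -(2 * Real.pi * Complex.I * (k : ℂ) * (x : ℂ)) by ring,
        Complex.exp_add, Complex.exp_add]
      ring
  have hii : ∀ n : ℤ, IntervalIntegrable
      (fun x : ℝ => Complex.exp (2 * Real.pi * Complex.I * (n : ℂ) * (x : ℂ)))
      MeasureTheory.volume (-(1 / 2 : ℝ)) (1 / 2 : ℝ) := fun n =>
    Continuous.intervalIntegrable (by fun_prop) _ _
  rw [fourierCoef, intervalIntegral.integral_congr fun x _ => hint x,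
    intervalIntegral.integral_add ((hii _).const_mul _)
      (Continuous.intervalIntegrable (by fun_prop) _ _),
    intervalIntegral.integral_const_mul, integral_exp_int,
    intervalIntegral.integral_finsetSum fun j _ => ((hii _).add (hii _)).const_mul _,
    if_neg (neg_ne_zero.2 hk0), mul_zero, zero_add]
  rw [Finset.sum_eq_single_of_mem k.natAbs hk]
  · rw [intervalIntegral.integral_const_mul, intervalIntegral.integral_add (hii _) (hii _),
      integral_exp_int, integral_exp_int]
    rcases le_total 0 k with h0 | h0
    · rw [if_pos (by omega), if_neg (by omega)]; ring
    · rw [if_neg (by omega), if_pos (by omega)]; ring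
  · intro j hj hne
    have := (Finset.mem_Icc.1 hj).1
    rw [intervalIntegral.integral_const_mul, intervalIntegral.integral_add (hii _) (hii _),
      integral_exp_int, integral_exp_int, if_neg (by omega), if_neg (by omega)]
    ring

end Fourier

/-! ### Comparison of the coefficients with those of the indicator function -/

section Weights

theorem abs_mul_cos_sub_sin_le {u : ℝ} (h0 : 0 ≤ u) (h1 : u ≤ Real.pi) :
    |u * Real.cos u - Real.sin u| ≤ u ^ 3 / 2 := by
  have hc := Real.one_sub_sq_div_two_le_cos (x := u)
  have hs := Real.sin_le h0
  rw [abs_le]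
  constructor
  · nlinarith
  · have : u * Real.cos u ≤ Real.sin u := by
      rcases lt_or_ge u (Real.pi / 2) with h | h
      · rcases h0.eq_or_lt with rfl | hpos
        · simp
        · have hcos : 0 < Real.cos u := Real.cos_pos_of_mem_Ioo ⟨by linarith, h⟩
          have := Real.lt_tan hpos h
          rw [Real.tan_eq_sin_div_cos, lt_div_iff₀ hcos] at this
          exact this.le
      · have hcos : Real.cos u ≤ 0 := Real.cos_nonpos_of_pi_div_two_le_of_le h (by linarith)
        exact (mul_nonpos_of_nonneg_of_nonpos h0 hcos).trans (Real.sin_nonneg_of_nonneg_of_le_pi h0 h1)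
    have : 0 ≤ u ^ 3 := by positivity
    linarith

theorem two_mul_le_sin_pi_mul {t : ℝ} (h0 : 0 ≤ t) (h1 : t ≤ 1) :
    2 * (t * (1 - t)) ≤ Real.sin (Real.pi * t) := by
  rcases le_total t (1 / 2) with h | h
  · have := Real.mul_le_sin (x := Real.pi * t) (by positivity) (by nlinarith [Real.pi_pos])
    have e : 2 / Real.pi * (Real.pi * t) = 2 * t := by field_simp
    rw [e] at this
    nlinarith
  · have := Real.mul_le_sin (x := Real.pi * (1 - t)) (mul_nonneg Real.pi_pos.le (by linarith))
      (by nlinarith [Real.pi_pos])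
    have e : 2 / Real.pi * (Real.pi * (1 - t)) = 2 * (1 - t) := by field_simp
    rw [e, show Real.pi * (1 - t) = Real.pi - Real.pi * t by ring, Real.sin_pi_sub] at this
    nlinarith

/-- After clearing the cotangent, the numerator (1 - t)(u cos u - sin u) with u = πt is O((1 -
t)t³), while sin(πt) is at least 2t(1 - t). The factor 1 - t cancels, so the bound is uniform up to
t = 1. -/
theorem abs_vaalerWeight_sub_one_le {t : ℝ} (h0 : 0 < t) (h1 : t < 1) :
    |vaalerWeight t - 1| ≤ 8 * t := by
  have hs := two_mul_le_sin_pi_mul h0.le h1.le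
  have hpos : 0 < t * (1 - t) := mul_pos h0 (by linarith)
  have hsin : 0 < Real.sin (Real.pi * t) := by linarith
  have e : vaalerWeight t - 1 = (1 - t) * (Real.pi * t * Real.cos (Real.pi * t) -
      Real.sin (Real.pi * t)) / Real.sin (Real.pi * t) := by
    rw [vaalerWeight, Real.cot_eq_cos_div_sin]
    field_simp
    ring
  have hb := abs_mul_cos_sub_sin_le (u := Real.pi * t) (by positivity)
    (by nlinarith [Real.pi_pos])
  rw [e, abs_div, abs_mul, abs_of_pos hsin, abs_of_pos (by linarith : 0 < 1 - t), div_le_iff₀ hsin]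
  have hpi : Real.pi ^ 3 ≤ 32 := by
    have h3 : Real.pi < 3.15 := Real.pi_lt_d2
    calc Real.pi ^ 3 ≤ 3.15 ^ 3 := pow_le_pow_left₀ Real.pi_pos.le h3.le 3
      _ ≤ 32 := by norm_num
  calc (1 - t) * |Real.pi * t * Real.cos (Real.pi * t) - Real.sin (Real.pi * t)|
      ≤ (1 - t) * ((Real.pi * t) ^ 3 / 2) := mul_le_mul_of_nonneg_left hb (by linarith)
    _ = Real.pi ^ 3 / 2 * (t * (1 - t)) * t ^ 2 := by ring
    _ ≤ 16 * (t * (1 - t)) * t := by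
        refine mul_le_mul (mul_le_mul_of_nonneg_right (by linarith) hpos.le) ?_ (by positivity)
          (by positivity)
        nlinarith
    _ ≤ 8 * t * Real.sin (Real.pi * t) := by nlinarith

/-- The coefficient `sin(πkβ)/(πk)` of the indicator function of `[-β/2, β/2]`. -/
def sincCoef (β : ℝ) (k : ℕ) : ℝ := Real.sin (Real.pi * k * β) / (Real.pi * k)

theorem abs_sincCoef_le (β : ℝ) (hβ : 0 ≤ β) (k : ℕ) : |sincCoef β k| ≤ β := by
  rcases Nat.eq_zero_or_pos k with rfl | hk
  · simpa [sincCoef] using hβ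
  have hk' : (0 : ℝ) < k := by exact_mod_cast hk
  rw [sincCoef, abs_div, abs_of_pos (mul_pos Real.pi_pos hk'), div_le_iff₀ (by positivity)]
  refine Real.abs_sin_le_abs.trans_eq ?_
  rw [abs_of_nonneg (by positivity)]; ring

theorem abs_sincCoef_le_inv (β : ℝ) (k : ℕ) : |sincCoef β k| ≤ 1 / k := by
  rcases Nat.eq_zero_or_pos k with rfl | hk
  · simp [sincCoef]
  have hk' : (1 : ℝ) ≤ k := by exact_mod_cast hk
  rw [sincCoef, abs_div, abs_of_pos (mul_pos Real.pi_pos (by linarith))]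
  refine div_le_div₀ zero_le_one (Real.abs_sin_le_one _) (by linarith) ?_
  nlinarith [Real.pi_gt_three]

/-- The Vaaler weight is off by at most 8k/(K+1) and multiplies a coefficient of size at most 1/k;
the Fejér part adds at most 1/(K+1). Hence 9 = 8 + 1. -/
theorem abs_selbergCoef_sub_le (K : ℕ) (β s : ℝ) (hs : |s| ≤ 1) (k : ℕ)
    (hk : k ∈ Finset.Icc 1 K) : |selbergCoef K β s k - sincCoef β k| ≤ 9 / K := by
  obtain ⟨hk1, hkK⟩ := Finset.mem_Icc.1 hk
  have hk0 : (0 : ℝ) < k := by exact_mod_cast hk1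
  have hK0 : (0 : ℝ) < K := by exact_mod_cast hk1.trans hkK
  have hkK' : (k : ℝ) ≤ K := by exact_mod_cast hkK
  have ht0 : 0 < (k : ℝ) / (K + 1) := by positivity
  have ht1 : (k : ℝ) / (K + 1) < 1 := by rw [div_lt_one (by positivity)]; linarith
  have e : selbergCoef K β s k - sincCoef β k =
      (vaalerWeight ((k : ℝ) / ((K : ℝ) + 1)) - 1) * sincCoef β k +
      s * ((1 - (k : ℝ) / ((K : ℝ) + 1)) * Real.cos (Real.pi * k * β) / ((K : ℝ) + 1)) := by
    rw [selbergCoef, sincCoef]; ring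
  rw [e]
  have h1 : |(vaalerWeight ((k : ℝ) / ((K : ℝ) + 1)) - 1) * sincCoef β k| ≤ 8 / K := by
    rw [abs_mul]
    calc _ ≤ (8 * ((k : ℝ) / (K + 1))) * (1 / k) :=
          mul_le_mul (abs_vaalerWeight_sub_one_le ht0 ht1) (abs_sincCoef_le_inv β k)
            (abs_nonneg _) (by positivity)
      _ = 8 / (K + 1) := by field_simp
      _ ≤ 8 / K := by gcongr; linarith
  have h2 : |s * ((1 - (k : ℝ) / ((K : ℝ) + 1)) * Real.cos (Real.pi * k * β) / ((K : ℝ) + 1))|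
      ≤ 1 / K := by
    rw [abs_mul, abs_div, abs_mul, abs_of_pos (by linarith : 0 < 1 - (k : ℝ) / ((K : ℝ) + 1)),
      abs_of_pos (by linarith : (0 : ℝ) < K + 1)]
    calc _ ≤ 1 * (1 * 1 / ((K : ℝ) + 1)) := by
          gcongr
          · linarith
          · exact Real.abs_cos_le_one _
      _ ≤ 1 / K := by rw [one_mul, one_mul]; gcongr; linarith
  calc _ ≤ 8 / (K : ℝ) + 1 / K := (abs_add_le _ _).trans (add_le_add h1 h2)
    _ = 9 / K := by ring

end Weights

/-! ### The logarithmic sum behind the variance, and geometric sums -/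

section RealSums

/-- Multiplying by 2 sin(πβ) makes the cosines a telescoping difference of bounded sines; summation
by parts against 1/m does the rest. -/
theorem abs_sum_cos_div_le (β : ℝ) (N K : ℕ) (hN : 1 ≤ N) (hNK : N ≤ K) :
    |∑ m ∈ Finset.Ioc N K, Real.cos (2 * Real.pi * m * β) / m| * |2 * Real.sin (Real.pi * β)|
      ≤ 2 / N := by
  set D : ℕ → ℝ := fun m => Real.sin ((2 * m - 1) * (Real.pi * β)) with hD
  have hD1 : ∀ m, |D m| ≤ 1 := fun m => Real.abs_sin_le_one _
  have hterm : ∀ m : ℕ, Real.cos (2 * Real.pi * m * β) / m * (2 * Real.sin (Real.pi * β)) =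
      (D (m + 1) - D m) / m := by
    intro m
    have e : D (m + 1) - D m =
        Real.cos (2 * Real.pi * m * β) * (2 * Real.sin (Real.pi * β)) := by
      simp only [hD]
      push_cast
      rw [show (2 * ((m : ℝ) + 1) - 1) * (Real.pi * β) = 2 * Real.pi * m * β + Real.pi * β by ring,
        show (2 * (m : ℝ) - 1) * (Real.pi * β) = 2 * Real.pi * m * β - Real.pi * β by ring,
        Real.sin_add, Real.sin_sub]
      ring
    rw [e]; ring
  -- Keeping the boundary term D(K+1)/K apart makes the partial summation an induction whose
  -- increments 1/K - 1/(K+1) telescope.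
  have key : |∑ m ∈ Finset.Ioc N K, (D (m + 1) - D m) / m - D (K + 1) / K| ≤ 2 / N - 1 / K := by
    have hN0 : (0 : ℝ) < N := by exact_mod_cast hN
    induction K, hNK using Nat.le_induction with
    | base =>
      rw [Finset.Ioc_self, Finset.sum_empty, zero_sub, abs_neg, abs_div, abs_of_pos hN0]
      calc |D (N + 1)| / N ≤ 1 / N := by gcongr; exact hD1 _
        _ = 2 / N - 1 / N := by ring
    | succ K hNK ih =>
      have hK0 : (0 : ℝ) < K := hN0.trans_le (by exact_mod_cast hNK)
      have hinv : 0 ≤ 1 / (K : ℝ) - 1 / (K + 1) := by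
        rw [sub_nonneg]; gcongr; linarith
      rw [Finset.sum_Ioc_succ_top hNK]
      push_cast
      have e : ∑ m ∈ Finset.Ioc N K, (D (m + 1) - D m) / m +
          (D (K + 1 + 1) - D (K + 1)) / ((K : ℝ) + 1) - D (K + 1 + 1) / ((K : ℝ) + 1) =
          (∑ m ∈ Finset.Ioc N K, (D (m + 1) - D m) / m - D (K + 1) / K) +
            D (K + 1) * (1 / (K : ℝ) - 1 / (K + 1)) := by ring
      rw [e]
      calc _ ≤ (2 / (N : ℝ) - 1 / K) + 1 * (1 / (K : ℝ) - 1 / (K + 1)) := by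
            refine (abs_add_le _ _).trans (add_le_add ih ?_)
            rw [abs_mul, abs_of_nonneg hinv]
            exact mul_le_mul_of_nonneg_right (hD1 _) hinv
        _ = 2 / (N : ℝ) - 1 / (K + 1) := by ring
  have hK0 : (0 : ℝ) < K := by exact_mod_cast hN.trans hNK
  rw [← abs_mul, Finset.sum_mul, Finset.sum_congr rfl fun m _ => hterm m]
  calc _ = |(∑ m ∈ Finset.Ioc N K, (D (m + 1) - D m) / m - D (K + 1) / K) + D (K + 1) / K| := by
        rw [sub_add_cancel]
    _ ≤ (2 / N - 1 / K) + 1 / K := by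
        refine (abs_add_le _ _).trans (add_le_add key ?_)
        rw [abs_div, abs_of_pos hK0]
        gcongr
        exact hD1 _
    _ = 2 / N := by ring

theorem abs_harmonic_sub_log_le (n : ℕ) (hn : 1 ≤ n) :
    0 ≤ ∑ m ∈ Finset.Ioc 0 n, (1 / (m : ℝ)) - Real.log n ∧
      ∑ m ∈ Finset.Ioc 0 n, (1 / (m : ℝ)) - Real.log n ≤ 1 := by
  have e : ∑ m ∈ Finset.Ioc 0 n, (1 / (m : ℝ)) = (harmonic n : ℝ) := by
    rw [harmonic_eq_sum_Icc, ← Finset.Icc_add_one_left_eq_Ioc]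
    push_cast
    simp
  have h1 := log_add_one_le_harmonic n
  have h2 := harmonic_le_one_add_log n
  have h3 : Real.log n ≤ Real.log ((n + 1 : ℕ) : ℝ) :=
    Real.log_le_log (by exact_mod_cast hn) (by push_cast; linarith)
  rw [e]
  constructor <;> linarith

/-- The sum is cut at N = ⌊1/β⌋. Up to N, |sin x| ≤ |x| gives a bounded contribution. Beyond N, sin²
= (1 - cos)/2 leaves half a harmonic sum, close to log(K/N) with Nβ in [1/2, 1], and an oscillating
sum controlled by sin(πβ) ≥ 2β(1 - η). -/
theorem abs_sum_sin_sq_div_sub_log_le (η β : ℝ) (K : ℕ) (hη : η < 1) (hβ : 0 < β) (hβη : β ≤ η)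
    (hK : 1 / β < K) :
    |∑ m ∈ Finset.Icc 1 K, Real.sin (Real.pi * m * β) ^ 2 / m - Real.log (K * β) / 2|
      ≤ 11 + 1 / (1 - η) := by
  set N := ⌊1 / β⌋₊ with hN
  have hβ1 : β < 1 := hβη.trans_lt hη
  have hN1 : 1 ≤ N := Nat.le_floor (by rw [Nat.cast_one, le_div_iff₀ hβ]; linarith)
  have hNle : (N : ℝ) ≤ 1 / β := Nat.floor_le (by positivity)
  have hNlt : 1 / β < N + 1 := Nat.lt_floor_add_one _
  have hNK : N ≤ K := by exact_mod_cast (hNle.trans hK.le)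
  have hN1' : (1 : ℝ) ≤ N := by exact_mod_cast hN1
  have hK0 : (0 : ℝ) < K := (by positivity : (0 : ℝ) < 1 / β).trans hK
  have hNβ : N * β ≤ 1 := by rwa [le_div_iff₀ hβ] at hNle
  have hNβ' : 1 < (N + 1) * β := by rwa [div_lt_iff₀ hβ] at hNlt
  have hNβ2 : 1 / 2 ≤ N * β := by nlinarith
  -- the initial range
  have hA0 : 0 ≤ ∑ m ∈ Finset.Ioc 0 N, Real.sin (Real.pi * m * β) ^ 2 / m :=
    Finset.sum_nonneg fun m _ => by positivity
  have hA : ∑ m ∈ Finset.Ioc 0 N, Real.sin (Real.pi * m * β) ^ 2 / m ≤ 10 := by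
    calc _ ≤ ∑ m ∈ Finset.Ioc 0 N, Real.pi ^ 2 * β ^ 2 * N := by
          refine Finset.sum_le_sum fun m hm => ?_
          have hm0 : (0 : ℝ) < m := by exact_mod_cast (Finset.mem_Ioc.1 hm).1
          have hmN : (m : ℝ) ≤ N := by exact_mod_cast (Finset.mem_Ioc.1 hm).2
          rw [div_le_iff₀ hm0]
          have h1 : Real.sin (Real.pi * m * β) ^ 2 ≤ (Real.pi * m * β) ^ 2 := by
            rw [sq_le_sq]
            exact Real.abs_sin_le_abs
          calc _ ≤ (Real.pi * m * β) ^ 2 := h1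
            _ = Real.pi ^ 2 * β ^ 2 * m * m := by ring
            _ ≤ Real.pi ^ 2 * β ^ 2 * N * m := by gcongr
      _ = Real.pi ^ 2 * (N * β) ^ 2 := by
          rw [Finset.sum_const, Nat.card_Ioc, nsmul_eq_mul, Nat.sub_zero]; ring
      _ ≤ Real.pi ^ 2 * 1 ^ 2 := by gcongr
      _ ≤ 10 := by nlinarith [Real.pi_lt_d2, Real.pi_pos]
  -- the oscillating part
  have hB : |∑ m ∈ Finset.Ioc N K, Real.cos (2 * Real.pi * m * β) / m| ≤ 1 / (1 - η) := by
    have h := abs_sum_cos_div_le β N K hN1 hNK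
    have hsin := two_mul_le_sin_pi_mul hβ.le hβ1.le
    have hη0 : 0 < 1 - η := by linarith
    have hs : 4 * β * (1 - η) ≤ |2 * Real.sin (Real.pi * β)| := by
      refine le_trans ?_ (le_abs_self _)
      nlinarith
    have h2 : 2 / (N : ℝ) ≤ 4 * β := by
      rw [div_le_iff₀ (by linarith)]; linarith
    rw [le_div_iff₀ hη0]
    have h3 := (mul_le_mul_of_nonneg_left hs (abs_nonneg
      (∑ m ∈ Finset.Ioc N K, Real.cos (2 * Real.pi * m * β) / m))).trans (h.trans h2)
    nlinarith
  -- the harmonic part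
  have hH : |∑ m ∈ Finset.Ioc N K, (1 / (m : ℝ)) - Real.log (K * β)| ≤ 2 := by
    have e : ∑ m ∈ Finset.Ioc N K, (1 / (m : ℝ)) =
        ∑ m ∈ Finset.Ioc 0 K, (1 / (m : ℝ)) - ∑ m ∈ Finset.Ioc 0 N, (1 / (m : ℝ)) := by
      rw [eq_sub_iff_add_eq', Finset.sum_Ioc_consecutive _ (Nat.zero_le N) hNK]
    have h1 := abs_harmonic_sub_log_le K (hN1.trans hNK)
    have h2 := abs_harmonic_sub_log_le N hN1
    have h3 : Real.log (K * β) = Real.log K + Real.log β := Real.log_mul hK0.ne' hβ.ne'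
    have h4 : Real.log (N * β) = Real.log N + Real.log β := Real.log_mul (by linarith) hβ.ne'
    have h5 : Real.log (N * β) ≤ 0 := Real.log_nonpos (by linarith) hNβ
    have h6 : -1 ≤ Real.log (N * β) := by
      have h7 : Real.log (1 / 2) ≤ Real.log (N * β) := Real.log_le_log (by norm_num) hNβ2
      have h8 : Real.log (1 / 2) = -Real.log 2 := by rw [one_div, Real.log_inv]
      have := Real.log_two_lt_d9
      linarith
    rw [e, abs_le]
    constructor <;> linarith [h1.1, h1.2, h2.1, h2.2]
  have hsplit : ∑ m ∈ Finset.Icc 1 K, Real.sin (Real.pi * m * β) ^ 2 / m =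
      ∑ m ∈ Finset.Ioc 0 N, Real.sin (Real.pi * m * β) ^ 2 / m +
      (∑ m ∈ Finset.Ioc N K, (1 / (m : ℝ)) -
        ∑ m ∈ Finset.Ioc N K, Real.cos (2 * Real.pi * m * β) / m) / 2 := by
    have : Finset.Icc 1 K = Finset.Ioc 0 K := Finset.Icc_add_one_left_eq_Ioc 0 K
    rw [this, ← Finset.sum_Ioc_consecutive _ (Nat.zero_le N) hNK]
    congr 1
    rw [← Finset.sum_sub_distrib, Finset.sum_div]
    refine Finset.sum_congr rfl fun m _ => ?_
    rw [Real.sin_sq_eq_half_sub, show 2 * (Real.pi * m * β) = 2 * Real.pi * m * β by ring]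
    ring
  rw [hsplit, abs_le]
  rw [abs_le] at hB hH
  have hη0 : 0 < 1 / (1 - η) := by
    have : 0 < 1 - η := by linarith
    positivity
  constructor <;> linarith [hB.1, hB.2, hH.1, hH.2]

theorem sum_pow_mul_le {w : ℝ} (h0 : 0 ≤ w) (h1 : w < 1) (m : ℕ) (hm : 1 ≤ m) (i K : ℕ) :
    ∑ r ∈ Finset.Icc i K, w ^ (r * m) ≤ w ^ (i * m) / (1 - w) := by
  have hwm : w ^ m ≤ w := by
    calc w ^ m ≤ w ^ 1 := pow_le_pow_of_le_one h0 h1.le hm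
      _ = w := pow_one w
  have hwm0 : 0 ≤ w ^ m := pow_nonneg h0 m
  have e : ∀ r, w ^ (r * m) = (w ^ m) ^ r := fun r => by rw [← pow_mul, mul_comm]
  simp only [e]
  have hpos : 0 < 1 - w := by linarith
  have hsub : Finset.Icc i K = Finset.Ico i (K + 1) := by
    ext; simp
  rw [hsub, Finset.sum_Ico_eq_sum_range]
  simp only [pow_add]
  rw [← Finset.mul_sum, div_eq_mul_inv]
  refine mul_le_mul_of_nonneg_left ?_ (pow_nonneg hwm0 i)
  rw [← one_div, le_div_iff₀ hpos]
  have h := geom_sum_mul_neg (w ^ m) (K + 1 - i)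
  have h2 : 0 ≤ ∑ j ∈ Finset.range (K + 1 - i), (w ^ m) ^ j :=
    Finset.sum_nonneg fun j _ => pow_nonneg hwm0 j
  have h3 := pow_nonneg hwm0 (K + 1 - i)
  nlinarith

end RealSums

/-! ### Reindexing by the product of degree and multiplicity -/

section Reindexing

theorem sum_Icc_Icc_eq_sum_divisors {M : Type*} [AddCommMonoid M] (K : ℕ) (G : ℕ → ℕ → M)
    (hG : ∀ m r, K < m * r → G m r = 0) :
    ∑ m ∈ Finset.Icc 1 K, ∑ r ∈ Finset.Icc 1 K, G m r =
      ∑ k ∈ Finset.Icc 1 K, ∑ m ∈ k.divisors, G m (k / m) := by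
  classical
  have h : ∑ m ∈ Finset.Icc 1 K, ∑ r ∈ Finset.Icc 1 K, G m r =
      ∑ x ∈ (Finset.Icc 1 K ×ˢ Finset.Icc 1 K).filter (fun x => x.1 * x.2 ≤ K), G x.1 x.2 := by
    rw [← Finset.sum_product']
    symm
    refine Finset.sum_filter_of_ne fun x _ hx => ?_
    by_contra hlt
    exact hx (hG _ _ (not_le.1 hlt))
  rw [h, Finset.sum_sigma']
  refine Finset.sum_bij' (fun x _ => ⟨x.1 * x.2, x.1⟩) (fun y _ => (y.2, y.1 / y.2)) ?_ ?_ ?_ ?_ ?_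
  · rintro ⟨m, r⟩ hx
    simp only [Finset.mem_filter, Finset.mem_product, Finset.mem_Icc] at hx
    simp only [Finset.mem_sigma, Finset.mem_Icc, Nat.mem_divisors]
    exact ⟨⟨Nat.mul_pos hx.1.1.1 hx.1.2.1, hx.2⟩, dvd_mul_right _ _,
      (Nat.mul_pos hx.1.1.1 hx.1.2.1).ne'⟩
  · rintro ⟨k, m⟩ hy
    simp only [Finset.mem_sigma, Finset.mem_Icc, Nat.mem_divisors] at hy
    obtain ⟨⟨hk1, hkK⟩, ⟨r, rfl⟩, -⟩ := hy
    have hm : 0 < m := Nat.pos_of_mul_pos_right hk1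
    have hr : 0 < r := Nat.pos_of_mul_pos_left hk1
    simp only [Finset.mem_filter, Finset.mem_product, Finset.mem_Icc, Nat.mul_div_cancel_left _ hm]
    exact ⟨⟨⟨hm, (Nat.le_mul_of_pos_right m hr).trans hkK⟩,
      ⟨hr, (Nat.le_mul_of_pos_left r hm).trans hkK⟩⟩, hkK⟩
  · rintro ⟨m, r⟩ hx
    simp only [Finset.mem_filter, Finset.mem_product, Finset.mem_Icc] at hx
    simp [Nat.mul_div_cancel_left _ hx.1.1.1]
  · rintro ⟨k, m⟩ hy
    simp only [Finset.mem_sigma, Finset.mem_Icc, Nat.mem_divisors] at hy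
    simp [Nat.mul_div_cancel' hy.2.1]
  · rintro ⟨m, r⟩ hx
    simp only [Finset.mem_filter, Finset.mem_product, Finset.mem_Icc] at hx
    simp [Nat.mul_div_cancel_left _ hx.1.1.1]

/-- For m ∣ k, the condition p ∣ k/m says that p ∣ k and m ∣ k/p. -/
theorem sum_divisors_filter_dvd {M : Type*} [AddCommMonoid M] (p k : ℕ) (hp : 0 < p) (hk : 0 < k)
    (g : ℕ → M) :
    ∑ m ∈ k.divisors, (if p ∣ k / m then g m else 0) =
      if p ∣ k then ∑ m ∈ (k / p).divisors, g m else 0 := by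
  rw [← Finset.sum_filter]
  split_ifs with h
  · obtain ⟨c, rfl⟩ := h
    rw [Nat.mul_div_cancel_left _ hp]
    refine Finset.sum_congr ?_ fun _ _ => rfl
    ext m
    simp only [Finset.mem_filter, Nat.mem_divisors]
    have hc : 0 < c := Nat.pos_of_mul_pos_left hk
    constructor
    · rintro ⟨⟨⟨e, he⟩, -⟩, h2⟩
      have hm : 0 < m := Nat.pos_of_mul_pos_right (he ▸ hk : 0 < m * e)
      rw [he, Nat.mul_div_cancel_left _ hm] at h2
      obtain ⟨f, rfl⟩ := h2
      refine ⟨⟨f, ?_⟩, hc.ne'⟩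
      exact Nat.eq_of_mul_eq_mul_left hp (by rw [he]; ring)
    · rintro ⟨⟨e, rfl⟩, -⟩
      have hm : 0 < m := Nat.pos_of_mul_pos_right hc
      refine ⟨⟨⟨p * e, by ring⟩, hk.ne'⟩, ?_⟩
      rw [show p * (m * e) = m * (p * e) by ring, Nat.mul_div_cancel_left _ hm]
      exact dvd_mul_right _ _
  · refine Finset.sum_eq_zero fun m hm => ?_
    simp only [Finset.mem_filter, Nat.mem_divisors] at hm
    exact absurd (hm.2.trans (Nat.div_dvd_of_dvd hm.1.1)) h

end Reindexing

/-! ### The number of closed points of given degree -/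

section Counting

variable {q : ℕ} {N : ℕ → ℕ}

theorem mul_count_le (hN : ∀ k, k ≠ 0 → ∑ m ∈ k.divisors, m * N m = q ^ k) (m : ℕ) (hm : 1 ≤ m) :
    m * N m ≤ q ^ m := by
  rw [← hN m (by omega)]
  exact Finset.single_le_sum (f := fun m => m * N m) (fun _ _ => Nat.zero_le _)
    (Nat.mem_divisors_self m (by omega))

theorem sum_Icc_pow_le (hq : 2 ≤ q) (n : ℕ) : ∑ i ∈ Finset.Icc 1 n, q ^ i ≤ 2 * q ^ n := by
  induction n with
  | zero => simp
  | succ n ih =>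
    rw [Finset.sum_Icc_succ_top (by omega), pow_succ]
    nlinarith [Nat.pow_pos (n := n) (by omega : 0 < q)]

/-- Proper divisors of m are at most m/2, and each contributes at most q^i to the divisor identity;
the geometric sum costs the factor 2. -/
theorem pow_le_mul_count_add (hq : 2 ≤ q)
    (hN : ∀ k, k ≠ 0 → ∑ m ∈ k.divisors, m * N m = q ^ k) (m : ℕ) (hm : 1 ≤ m) :
    q ^ m ≤ m * N m + 2 * q ^ (m / 2) := by
  rw [← hN m (by omega), ← Finset.add_sum_erase _ _ (Nat.mem_divisors_self m (by omega))]
  refine Nat.add_le_add_left ?_ _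
  refine le_trans ?_ (sum_Icc_pow_le hq (m / 2))
  refine (Finset.sum_le_sum (g := fun i => q ^ i) fun i hi => mul_count_le hN i ?_).trans
    (Finset.sum_le_sum_of_subset ?_)
  · exact Nat.pos_of_mem_divisors (Finset.mem_of_mem_erase hi)
  · intro i hi
    rw [Finset.mem_erase, Nat.mem_divisors] at hi
    obtain ⟨hne, ⟨e, rfl⟩, h0⟩ := hi
    rw [Finset.mem_Icc]
    have hi0 : 0 < i := Nat.pos_of_mul_pos_right (Nat.pos_of_ne_zero h0)
    have he : 2 ≤ e := by
      rcases e with _ | _ | e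
      · simp at h0
      · simp at hne
      · omega
    refine ⟨hi0, ?_⟩
    rw [Nat.le_div_iff_mul_le two_pos]
    exact Nat.mul_le_mul_left i he

end Counting

/-! ### Contributions of single points; the mean and the higher cumulants -/

section LocalSums

/-- What the estimates use of the coefficients of the Beurling-Selberg polynomials. -/
structure AdmissibleWeights (a : ℕ → ℝ) (K : ℕ) (β : ℝ) : Prop where
  pos : 0 < β
  lt_one : β < 1
  lt_mul : 1 < K * β
  eq_zero : ∀ k, K < k → a k = 0
  le_length : ∀ k, |a k| ≤ 10 * β
  le_inv : ∀ k, 1 ≤ k → |a k| ≤ 10 / k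
  approx : ∀ k, 1 ≤ k → |a k - sincCoef β k| ≤ 10 / K

/-- The constant 10 is 9 from the comparison with `sincCoef` plus 1 from `sincCoef` itself; 1/K < β
turns the error 9/K into 9β. Extension by zero keeps the approximation, since `sincCoef` is at most
1/k < 1/K beyond K. -/
theorem AdmissibleWeights.selberg (K : ℕ) (β s : ℝ) (hs : |s| ≤ 1) (hβ : 0 < β) (hβ1 : β < 1)
    (hK : 1 < K * β) :
    AdmissibleWeights (fun k => if k ∈ Finset.Icc 1 K then selbergCoef K β s k else 0) K β := by
  have hK0 : (0 : ℝ) < K := by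
    by_contra h
    nlinarith
  have hKinv : 1 / (K : ℝ) ≤ β := by rw [div_le_iff₀ hK0]; linarith
  have happrox : ∀ k, 1 ≤ k →
      |(if k ∈ Finset.Icc 1 K then selbergCoef K β s k else 0) - sincCoef β k| ≤ 9 / K := by
    intro k hk
    split_ifs with h
    · exact abs_selbergCoef_sub_le K β s hs k h
    · rw [zero_sub, abs_neg]
      refine (abs_sincCoef_le_inv β k).trans ?_
      have : (K : ℝ) ≤ k := by
        rw [Finset.mem_Icc, not_and, not_le] at h
        exact_mod_cast (h hk).le
      gcongr
      norm_num
  refine ⟨hβ, hβ1, hK, fun k hk => if_neg ?_, fun k => ?_, fun k hk => ?_, fun k hk => ?_⟩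
  · rw [Finset.mem_Icc]; omega
  · split_ifs with h
    · have h1 := abs_selbergCoef_sub_le K β s hs k h
      have h2 := abs_sincCoef_le β hβ.le k
      have h3 := abs_sub_abs_le_abs_sub (selbergCoef K β s k) (sincCoef β k)
      have : 9 / (K : ℝ) = 9 * (1 / K) := by ring
      linarith
    · rw [abs_zero]; positivity
  · split_ifs with h
    · have h1 := abs_selbergCoef_sub_le K β s hs k h
      have h2 := abs_sincCoef_le_inv β k
      have h3 := abs_sub_abs_le_abs_sub (selbergCoef K β s k) (sincCoef β k)
      have h4 : 9 / (K : ℝ) ≤ 9 / k := by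
        have : (k : ℝ) ≤ K := by exact_mod_cast (Finset.mem_Icc.1 h).2
        have : (0 : ℝ) < k := by exact_mod_cast hk
        gcongr
      have : 10 / (k : ℝ) = 9 / k + 1 / k := by ring
      linarith
    · rw [abs_zero]; positivity
  · refine (happrox k hk).trans ?_
    gcongr
    norm_num

variable {p : ℕ} [Fact p.Prime]

/-- The contribution to the weighted sum of a closed point of degree `m`, as a function of the
local trace. -/
def localSum (ψ : AddChar (ZMod p) ℂ) (a : ℕ → ℝ) (w : ℝ) (K m : ℕ) (z : ZMod p) : ℂ :=
  ∑ r ∈ Finset.Icc 1 K, ((m * a (r * m) * w ^ (r * m) : ℝ) : ℂ) * (ψ (r * z) + ψ⁻¹ (r * z))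

theorem norm_charPair_le (ψ : AddChar (ZMod p) ℂ) (z : ZMod p) : ‖ψ z + ψ⁻¹ z‖ ≤ 2 := by
  refine (norm_add_le _ _).trans ?_
  rw [AddChar.norm_apply, AddChar.norm_apply]
  norm_num

theorem sum_char_mul {ψ : AddChar (ZMod p) ℂ} (hψ : ψ ≠ 1) (b : ZMod p) :
    ∑ z : ZMod p, ψ (b * z) = if b = 0 then (p : ℂ) else 0 := by
  have h := AddChar.sum_mulShift b (AddChar.IsPrimitive.of_ne_one hψ)
  simp only [mul_comm b]
  rw [h, ZMod.card]
  split_ifs <;> simp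

theorem sum_charPair {ψ : AddChar (ZMod p) ℂ} (hψ : ψ ≠ 1) (r : ℕ) :
    ∑ z : ZMod p, (ψ (r * z) + ψ⁻¹ (r * z)) = if p ∣ r then 2 * (p : ℂ) else 0 := by
  have hψ' : ψ⁻¹ ≠ 1 := inv_ne_one.2 hψ
  rw [Finset.sum_add_distrib, sum_char_mul hψ, sum_char_mul hψ']
  simp only [CharP.cast_eq_zero_iff (ZMod p) p]
  split_ifs <;> ring

/-- The square is ψ(2z) + ψ(-2z) + 2. For odd p the first two terms average to zero; for p = 2 they
would be constant and double the variance. -/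
theorem sum_charPair_sq (hp : p ≠ 2) {ψ : AddChar (ZMod p) ℂ} (hψ : ψ ≠ 1) :
    ∑ z : ZMod p, (ψ z + ψ⁻¹ z) ^ 2 = 2 * p := by
  have e : ∀ z : ZMod p, (ψ z + ψ⁻¹ z) ^ 2 = (ψ (2 * z) + ψ (-2 * z)) + 2 := by
    intro z
    have h1 : ψ z * ψ (-z) = 1 := by rw [← AddChar.map_add_eq_mul, add_neg_cancel, AddChar.map_zero_eq_one]
    rw [AddChar.inv_apply, show 2 * z = z + z by ring, show -2 * z = -z + -z by ring,
      AddChar.map_add_eq_mul, AddChar.map_add_eq_mul]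
    linear_combination 2 * h1
  have h2 : (2 : ZMod p) ≠ 0 := by
    have h : ¬ p ∣ 2 := fun h => hp ((Nat.prime_dvd_prime_iff_eq Fact.out Nat.prime_two).1 h)
    rw [← CharP.cast_eq_zero_iff (ZMod p) p 2] at h
    exact_mod_cast h
  simp only [e]
  rw [Finset.sum_add_distrib, Finset.sum_add_distrib, sum_char_mul hψ, sum_char_mul hψ,
    if_neg h2, if_neg (neg_ne_zero.2 h2), Finset.sum_const, Finset.card_univ, ZMod.card]
  simp
  ring

variable {a : ℕ → ℝ} {K : ℕ} {β w : ℝ}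

/-- The minimum combines the two bounds on the weights: mβ supplies the factor β needed for the
cumulants, and 1 supplies boundedness in m. A free starting index i allows r ≥ 2 to be treated as a
smaller remainder in the variance. -/
theorem norm_sum_localTerm_le (ha : AdmissibleWeights a K β) (hw0 : 0 < w) (hw1 : w < 1)
    (ψ : AddChar (ZMod p) ℂ) (m i : ℕ) (hm : 1 ≤ m) (hi : 1 ≤ i) (z : ZMod p) :
    ‖∑ r ∈ Finset.Icc i K, ((m * a (r * m) * w ^ (r * m) : ℝ) : ℂ) * (ψ (r * z) + ψ⁻¹ (r * z))‖
      ≤ 20 / (1 - w) * min (m * β) 1 * w ^ (i * m) := by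
  have hm0 : (0 : ℝ) < m := by exact_mod_cast hm
  have hmin : 0 ≤ min (m * β) 1 := le_min (mul_nonneg hm0.le ha.pos.le) zero_le_one
  calc _ ≤ ∑ r ∈ Finset.Icc i K, 20 * min (m * β) 1 * w ^ (r * m) := by
        refine (norm_sum_le _ _).trans (Finset.sum_le_sum fun r hr => ?_)
        have hr1 : 1 ≤ r := hi.trans (Finset.mem_Icc.1 hr).1
        have hr1' : (1 : ℝ) ≤ r := by exact_mod_cast hr1
        rw [norm_mul, Complex.norm_real, Real.norm_eq_abs, abs_mul, abs_mul, abs_of_pos hm0,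
          abs_of_nonneg (pow_nonneg hw0.le _)]
        have hA : m * |a (r * m)| ≤ 10 * min (m * β) 1 := by
          rw [mul_min_of_nonneg _ _ (by norm_num : (0 : ℝ) ≤ 10)]
          refine le_min ?_ ?_
          · have := ha.le_length (r * m)
            nlinarith
          · have h := ha.le_inv (r * m) (Nat.mul_pos hr1 hm)
            push_cast at h
            have h2 : 10 / ((r : ℝ) * m) ≤ 10 / m := by
              gcongr
              nlinarith
            have h3 := mul_le_mul_of_nonneg_left (h.trans h2) hm0.le
            rwa [mul_div_cancel₀ _ hm0.ne', ← mul_one (10 : ℝ)] at h3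
        calc _ ≤ 10 * min (m * β) 1 * w ^ (r * m) * 2 :=
              mul_le_mul (mul_le_mul_of_nonneg_right hA (pow_nonneg hw0.le _))
                (norm_charPair_le ψ _) (norm_nonneg _) (by positivity)
          _ = 20 * min (m * β) 1 * w ^ (r * m) := by ring
    _ = 20 * min (m * β) 1 * ∑ r ∈ Finset.Icc i K, w ^ (r * m) := by rw [Finset.mul_sum]
    _ ≤ 20 * min (m * β) 1 * (w ^ (i * m) / (1 - w)) :=
        mul_le_mul_of_nonneg_left (sum_pow_mul_le hw0.le hw1 m hm i K) (by positivity)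
    _ = _ := by ring

theorem norm_localSum_le (ha : AdmissibleWeights a K β) (hw0 : 0 < w) (hw1 : w < 1)
    (ψ : AddChar (ZMod p) ℂ) (m : ℕ) (hm : 1 ≤ m) (z : ZMod p) :
    ‖localSum ψ a w K m z‖ ≤ 20 / (1 - w) * min (m * β) 1 * w ^ m := by
  have := norm_sum_localTerm_le ha hw0 hw1 ψ m 1 hm le_rfl z
  rwa [one_mul] at this

/-- The coefficient of order `i` in the logarithmic derivative of the exponential generating
function of the moments: the cumulant of order `i + 1`, divided by `i!`. -/
def cumulant (N : ℕ → ℕ) (ψ : AddChar (ZMod p) ℂ) (a : ℕ → ℝ) (w : ℝ) (K i : ℕ) : ℂ :=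
  ∑ m ∈ Finset.Icc 1 K, (N m : ℂ) *
    PowerSeries.coeff i (logDerivSeries (momentSeries (localSum ψ a w K m)))

variable {q : ℕ} {N : ℕ → ℕ}

theorem count_mul_le (hN : ∀ k, k ≠ 0 → ∑ m ∈ k.divisors, m * N m = q ^ k) (hwq : w ^ 2 * q = 1)
    (m : ℕ) (hm : 1 ≤ m) : m * (N m : ℝ) * w ^ (2 * m) ≤ 1 := by
  have h : (m : ℝ) * N m ≤ q ^ m := by exact_mod_cast mul_count_le hN m hm
  calc _ ≤ (q : ℝ) ^ m * w ^ (2 * m) := by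
        refine mul_le_mul_of_nonneg_right h ?_
        rw [pow_mul]
        positivity
    _ = (w ^ 2 * q) ^ m := by rw [mul_pow, ← pow_mul, mul_comm]
    _ = 1 := by rw [hwq, one_pow]

theorem count_mul_le' (hN : ∀ k, k ≠ 0 → ∑ m ∈ k.divisors, m * N m = q ^ k) (hwq : w ^ 2 * q = 1)
    (m : ℕ) (hm : 1 ≤ m) : (N m : ℝ) * w ^ (2 * m) ≤ 1 := by
  refine le_trans ?_ (count_mul_le hN hwq m hm)
  refine mul_le_mul_of_nonneg_right ?_ ?_
  · have : (1 : ℝ) ≤ m := by exact_mod_cast hm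
    nlinarith [(N m).cast_nonneg (α := ℝ)]
  · rw [pow_mul]; positivity

/-- A local cumulant of order i + 1 ≥ 3 is O((min(mβ, 1)·w^m)^{i+1}). Two powers of w^m absorb the
number of points, the others make the sum over m converge, and one factor of the minimum gives β. -/
theorem exists_norm_cumulant_le (q : ℕ) (w : ℝ) (hw0 : 0 < w) (hw1 : w < 1) (hwq : w ^ 2 * q = 1)
    (N : ℕ → ℕ) (hN : ∀ k, k ≠ 0 → ∑ m ∈ k.divisors, m * N m = q ^ k) (i : ℕ) (hi : 2 ≤ i) :
    ∃ A : ℝ, ∀ (ψ : AddChar (ZMod p) ℂ) (a : ℕ → ℝ) (K : ℕ) (β : ℝ),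
      AdmissibleWeights a K β → ‖cumulant N ψ a w K i‖ ≤ A * β := by
  obtain ⟨c, hc0, hc⟩ := exists_norm_coeff_logDerivSeries_le i
  have hsum : Summable fun m : ℕ => (m : ℝ) * w ^ m := by
    have := summable_pow_mul_geometric_of_norm_lt_one 1 (r := w) (by
      rw [Real.norm_eq_abs, abs_of_pos hw0]; exact hw1)
    simpa using this
  set D : ℝ := 20 / (1 - w) with hD
  have hD0 : 0 ≤ D := div_nonneg (by norm_num) (by linarith)
  refine ⟨c * D ^ (i + 1) * ∑' m : ℕ, (m : ℝ) * w ^ m, fun ψ a K β ha => ?_⟩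
  rw [cumulant]
  calc _ ≤ ∑ m ∈ Finset.Icc 1 K, c * D ^ (i + 1) * β * ((m : ℝ) * w ^ m) := by
        refine (norm_sum_le _ _).trans (Finset.sum_le_sum fun m hm => ?_)
        have hm1 := (Finset.mem_Icc.1 hm).1
        have hm0 : (0 : ℝ) < m := by exact_mod_cast hm1
        have hmin0 : 0 ≤ min (m * β) 1 := le_min (mul_nonneg hm0.le ha.pos.le) zero_le_one
        have hB := hc (momentSeries (localSum ψ a w K m)) (D * min (m * β) 1 * w ^ m)
          (constantCoeff_momentSeries _) (by positivity)
          (norm_coeff_momentSeries_le _ (norm_localSum_le ha hw0 hw1 ψ m hm1))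
        have hcount := count_mul_le' hN hwq m hm1
        rw [norm_mul, Complex.norm_natCast]
        calc _ ≤ (N m : ℝ) * (c * (D * min (m * β) 1 * w ^ m) ^ (i + 1)) :=
              mul_le_mul_of_nonneg_left hB (Nat.cast_nonneg _)
          _ = c * D ^ (i + 1) * min (m * β) 1 ^ (i + 1) * ((N m : ℝ) * w ^ (2 * m)) *
                w ^ ((i - 1) * m) := by
              have e : w ^ (m * (i + 1)) = w ^ (2 * m) * w ^ ((i - 1) * m) := by
                rw [← pow_add, ← add_mul, mul_comm]
                congr 2; omega
              rw [mul_pow, mul_pow, ← pow_mul, e]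
              ring
          _ ≤ c * D ^ (i + 1) * (m * β) * 1 * w ^ m := by
              have h1 : min (m * β) 1 ^ (i + 1) ≤ m * β := by
                calc _ ≤ min (m * β) 1 ^ 1 :=
                      pow_le_pow_of_le_one hmin0 (min_le_right _ _) (by omega)
                  _ ≤ m * β := by rw [pow_one]; exact min_le_left _ _
              have h2 : w ^ ((i - 1) * m) ≤ w ^ m :=
                pow_le_pow_of_le_one hw0.le hw1.le (Nat.le_mul_of_pos_left m (by omega))
              have := ha.pos
              gcongr
          _ = c * D ^ (i + 1) * β * ((m : ℝ) * w ^ m) := by ring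
    _ = c * D ^ (i + 1) * β * ∑ m ∈ Finset.Icc 1 K, (m : ℝ) * w ^ m := by rw [Finset.mul_sum]
    _ ≤ c * D ^ (i + 1) * β * ∑' m : ℕ, (m : ℝ) * w ^ m := by
        have := ha.pos
        exact mul_le_mul_of_nonneg_left
          (hsum.sum_le_tsum _ fun m _ => by positivity) (by positivity)
    _ = _ := by ring

theorem sum_localSum {ψ : AddChar (ZMod p) ℂ} (hψ : ψ ≠ 1) (m : ℕ) :
    (∑ z, localSum ψ a w K m z) / (p : ℂ) = ∑ r ∈ Finset.Icc 1 K,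
      if p ∣ r then 2 * ((m * a (r * m) * w ^ (r * m) : ℝ) : ℂ) else 0 := by
  have hp0 : (p : ℂ) ≠ 0 := by exact_mod_cast (Fact.out : p.Prime).ne_zero
  simp only [localSum]
  rw [Finset.sum_comm, Finset.sum_div]
  refine Finset.sum_congr rfl fun r _ => ?_
  rw [← Finset.mul_sum, sum_charPair hψ]
  split_ifs
  · field_simp
  · simp

/-- Averaging over the local trace kills every multiplicity r not divisible by p. Collecting the
rest by k = rm leaves the sum of m N_m over m ∣ k/p, which is exactly q^{k/p}. -/
theorem cumulant_zero_eq (ha : AdmissibleWeights a K β) {ψ : AddChar (ZMod p) ℂ} (hψ : ψ ≠ 1)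
    (hN : ∀ k, k ≠ 0 → ∑ m ∈ k.divisors, m * N m = q ^ k) :
    cumulant N ψ a w K 0 = 2 * ((∑ k ∈ Finset.Icc 1 K,
      if p ∣ k then a k * w ^ k * (q : ℝ) ^ (k / p) else 0 : ℝ) : ℂ) := by
  have hp0 : 0 < p := (Fact.out : p.Prime).pos
  have h1 : ∀ m, (N m : ℂ) * PowerSeries.coeff 0
      (logDerivSeries (momentSeries (localSum ψ a w K m))) = ∑ r ∈ Finset.Icc 1 K,
        (if p ∣ r then 2 * ((m * N m : ℕ) : ℂ) * ((a (r * m) * w ^ (r * m) : ℝ) : ℂ) else 0) := by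
    intro m
    rw [coeff_zero_logDerivSeries (constantCoeff_momentSeries _), coeff_momentSeries]
    simp only [pow_one, Nat.factorial_one, Nat.cast_one, div_one, ZMod.card]
    rw [sum_localSum hψ, Finset.mul_sum]
    refine Finset.sum_congr rfl fun r _ => ?_
    split_ifs
    · push_cast; ring
    · rw [mul_zero]
  rw [cumulant, Finset.sum_congr rfl fun m _ => h1 m,
    sum_Icc_Icc_eq_sum_divisors K fun m r =>
      if p ∣ r then 2 * ((m * N m : ℕ) : ℂ) * ((a (r * m) * w ^ (r * m) : ℝ) : ℂ) else 0]
  · rw [Complex.ofReal_sum, Finset.mul_sum]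
    refine Finset.sum_congr rfl fun k hk => ?_
    have hk0 : 0 < k := (Finset.mem_Icc.1 hk).1
    have e : ∀ m ∈ k.divisors, (if p ∣ k / m then 2 * ((m * N m : ℕ) : ℂ) *
        ((a (k / m * m) * w ^ (k / m * m) : ℝ) : ℂ) else 0) =
        if p ∣ k / m then 2 * ((m * N m : ℕ) : ℂ) * ((a k * w ^ k : ℝ) : ℂ) else 0 := by
      intro m hm
      rw [Nat.div_mul_cancel (Nat.dvd_of_mem_divisors hm)]
    rw [Finset.sum_congr rfl e, sum_divisors_filter_dvd p k hp0 hk0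
      fun m => 2 * ((m * N m : ℕ) : ℂ) * ((a k * w ^ k : ℝ) : ℂ)]
    split_ifs with h
    · have hkp : k / p ≠ 0 := (Nat.div_pos (Nat.le_of_dvd hk0 h) hp0).ne'
      rw [← Finset.sum_mul, ← Finset.mul_sum, ← Nat.cast_sum, hN _ hkp]
      push_cast
      ring
    · simp
  · intro m r hlt
    rw [mul_comm] at hlt
    rw [ha.eq_zero _ hlt]
    simp

theorem rpow_theta (hw0 : 0 < w) (hwq : w ^ 2 * q = 1) (k : ℕ) (hk : p ∣ k) :
    w ^ k * (q : ℝ) ^ (k / p) = (q : ℝ) ^ (-((1 / 2 - 1 / (p : ℝ)) * (k : ℝ))) := by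
  have hp0 : 0 < p := (Fact.out : p.Prime).pos
  have hp0' : (p : ℝ) ≠ 0 := by exact_mod_cast hp0.ne'
  have hq0 : (0 : ℝ) < q := by
    by_contra h
    have : 0 < w ^ 2 := by positivity
    nlinarith
  have hw : w = (q : ℝ) ^ (-(1 / 2) : ℝ) := by
    rw [Real.rpow_neg hq0.le, ← Real.sqrt_eq_rpow]
    refine eq_inv_of_mul_eq_one_left ?_
    have hs := Real.sq_sqrt hq0.le
    have h1 : (w * √(q : ℝ)) ^ 2 = 1 := by rw [mul_pow, hs, hwq]
    exact (pow_eq_one_iff_of_nonneg (mul_pos hw0 (Real.sqrt_pos.2 hq0)).le two_ne_zero).1 h1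
  obtain ⟨c, rfl⟩ := hk
  rw [Nat.mul_div_cancel_left _ hp0, hw, ← Real.rpow_natCast, ← Real.rpow_natCast,
    ← Real.rpow_mul hq0.le, ← Real.rpow_add hq0]
  congr 1
  push_cast
  field_simp
  ring

/-- As p ≥ 3, the exponent 1/2 - 1/p is positive, so both series are dominated by a geometric one.
Replacing the weights by `sincCoef` costs 10/K per coefficient. -/
theorem exists_norm_cumulant_zero_sub_le (hp : p ≠ 2) (q : ℕ) (w : ℝ) (hw0 : 0 < w) (hw1 : w < 1)
    (hwq : w ^ 2 * q = 1)
    (N : ℕ → ℕ) (hN : ∀ k, k ≠ 0 → ∑ m ∈ k.divisors, m * N m = q ^ k) :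
    ∃ A : ℝ, 0 ≤ A ∧ ∀ (ψ : AddChar (ZMod p) ℂ) (a : ℕ → ℝ) (K : ℕ) (β : ℝ), ψ ≠ 1 →
      AdmissibleWeights a K β →
      ‖cumulant N ψ a w K 0 - ((2 * constC p q β : ℝ) : ℂ)‖ ≤ A / K ∧
        |constC p q β| ≤ A * β := by
  have hq1 : (1 : ℝ) < q := by
    by_contra h
    have : w ^ 2 < 1 := by nlinarith
    have h0 : (0 : ℝ) ≤ q := Nat.cast_nonneg q
    nlinarith
  have hp3 : (3 : ℝ) ≤ p := by
    have h2 := (Fact.out : p.Prime).two_le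
    have : 3 ≤ p := by omega
    exact_mod_cast this
  set θ : ℝ := (q : ℝ) ^ (-(1 / 2 - 1 / (p : ℝ))) with hθ
  have hθ0 : 0 < θ := Real.rpow_pos_of_pos (by linarith) _
  have hexp : 0 < 1 / 2 - 1 / (p : ℝ) := by
    have : 1 / (p : ℝ) ≤ 1 / 3 := by gcongr
    linarith
  have hθ1 : θ < 1 := Real.rpow_lt_one_of_one_lt_of_neg hq1 (by linarith)
  have hθk : ∀ k : ℕ, (q : ℝ) ^ (-((1 / 2 - 1 / (p : ℝ)) * (k : ℝ))) = θ ^ k := by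
    intro k
    rw [hθ, ← Real.rpow_natCast, ← Real.rpow_mul (by linarith), neg_mul]
  have hgeom : Summable fun j : ℕ => θ ^ (j + 1) :=
    (summable_nat_add_iff 1).2 (summable_geometric_of_lt_one hθ0.le hθ1)
  set T : ℝ := ∑' j : ℕ, θ ^ (j + 1) with hT
  have hT0 : 0 ≤ T := tsum_nonneg fun j => by positivity
  refine ⟨20 * T, by positivity, fun ψ a K β hψ ha => ?_⟩
  have hC : constC p q β = ∑' j : ℕ, if p ∣ j + 1 then sincCoef β (j + 1) * θ ^ (j + 1) else 0 := by
    rw [constC]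
    refine tsum_congr fun j => ?_
    rw [hθk, sincCoef]
  -- Applied to `sincCoef`, to the weights, and to their difference.
  have hbound : ∀ (b : ℕ → ℝ) (B : ℝ), (∀ k, 1 ≤ k → |b k| ≤ B) →
      Summable (fun j : ℕ => if p ∣ j + 1 then b (j + 1) * θ ^ (j + 1) else 0) ∧
      |∑' j : ℕ, if p ∣ j + 1 then b (j + 1) * θ ^ (j + 1) else 0| ≤ B * T := by
    intro b B hb
    have hB0 : 0 ≤ B := (abs_nonneg _).trans (hb 1 le_rfl)
    have hle : ∀ j : ℕ, ‖(if p ∣ j + 1 then b (j + 1) * θ ^ (j + 1) else 0 : ℝ)‖ ≤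
        B * θ ^ (j + 1) := by
      intro j
      split_ifs
      · rw [norm_mul, Real.norm_eq_abs, Real.norm_eq_abs, abs_of_pos (pow_pos hθ0 _)]
        exact mul_le_mul_of_nonneg_right (hb _ (by omega)) (by positivity)
      · rw [norm_zero]; positivity
    refine ⟨Summable.of_norm_bounded (hgeom.mul_left B) hle, ?_⟩
    have := tsum_of_norm_bounded (hgeom.hasSum.mul_left B) hle
    exact this
  have hsinc := hbound (sincCoef β) β fun k _ => abs_sincCoef_le β ha.pos.le k
  have hdiff := hbound (fun k => a k - sincCoef β k) (10 / K) ha.approx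
  have hak := hbound a (10 * β) fun k _ => ha.le_length k
  constructor
  · have h1 : (∑ k ∈ Finset.Icc 1 K, if p ∣ k then a k * w ^ k * (q : ℝ) ^ (k / p) else 0 : ℝ) =
        ∑' j : ℕ, if p ∣ j + 1 then a (j + 1) * θ ^ (j + 1) else 0 := by
      rw [tsum_eq_sum (s := Finset.range K)]
      · rw [Finset.range_eq_Ico, Finset.sum_Ico_add' (fun k => if p ∣ k then a k * θ ^ k else 0) 0 K 1]
        rw [show Finset.Ico (0 + 1) (K + 1) = Finset.Icc 1 K by ext; simp]
        refine Finset.sum_congr rfl fun k _ => ?_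
        split_ifs with h
        · rw [mul_assoc, rpow_theta hw0 hwq k h, hθk]
        · rfl
      · intro j hj
        rw [Finset.mem_range, not_lt] at hj
        rw [ha.eq_zero (j + 1) (by omega)]
        simp
    have h2 : (∑' j : ℕ, if p ∣ j + 1 then a (j + 1) * θ ^ (j + 1) else 0) - constC p q β =
        ∑' j : ℕ, if p ∣ j + 1 then (a (j + 1) - sincCoef β (j + 1)) * θ ^ (j + 1) else 0 := by
      rw [hC, ← hak.1.tsum_sub hsinc.1]
      refine tsum_congr fun j => ?_
      split_ifs
      · ring
      · ring
    rw [cumulant_zero_eq ha hψ hN, h1, Complex.ofReal_mul, Complex.ofReal_ofNat, ← mul_sub,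
      ← Complex.ofReal_sub, h2, norm_mul, Complex.norm_real, Real.norm_eq_abs, Complex.norm_ofNat]
    calc _ ≤ 2 * (10 / K * T) := mul_le_mul_of_nonneg_left hdiff.2 (by norm_num)
      _ = 20 * T / K := by ring
  · rw [hC]
    refine hsinc.2.trans ?_
    have := mul_nonneg ha.pos.le hT0
    linarith

end LocalSums

/-! ### The second cumulant -/

section Variance

variable {p : ℕ} [Fact p.Prime] {a : ℕ → ℝ} {K : ℕ} {β w : ℝ} {q : ℕ} {N : ℕ → ℕ}

theorem norm_sum_div_card_le {f : ZMod p → ℂ} {B : ℝ} (hf : ∀ z, ‖f z‖ ≤ B) :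
    ‖(∑ z, f z) / (p : ℂ)‖ ≤ B := by
  have hp0 : (0 : ℝ) < p := by exact_mod_cast (Fact.out : p.Prime).pos
  rw [norm_div, Complex.norm_natCast, div_le_iff₀ hp0]
  calc _ ≤ ∑ _z : ZMod p, B := (norm_sum_le _ _).trans (Finset.sum_le_sum fun z _ => hf z)
    _ = B * p := by rw [Finset.sum_const, Finset.card_univ, ZMod.card, nsmul_eq_mul, mul_comm]

theorem coeff_one_logDerivSeries_momentSeries (v : ZMod p → ℂ) :
    PowerSeries.coeff 1 (logDerivSeries (momentSeries v)) =
      (∑ z, v z ^ 2) / (p : ℂ) - ((∑ z, v z) / (p : ℂ)) ^ 2 := by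
  rw [coeff_one_logDerivSeries (constantCoeff_momentSeries v), coeff_momentSeries,
    coeff_momentSeries, ZMod.card]
  simp
  ring

/-- The variance of the contribution of a single point. -/
theorem norm_coeff_one_sub_le (hp : p ≠ 2) (ha : AdmissibleWeights a K β) (hw0 : 0 < w)
    (hw1 : w < 1) {ψ : AddChar (ZMod p) ℂ} (hψ : ψ ≠ 1) (m : ℕ) (hm : m ∈ Finset.Icc 1 K) :
    ‖PowerSeries.coeff 1 (logDerivSeries (momentSeries (localSum ψ a w K m))) -
      ((2 * (m * a m * w ^ m) ^ 2 : ℝ) : ℂ)‖ ≤ 4 * (20 / (1 - w)) ^ 2 * w ^ (3 * m) := by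
  obtain ⟨hm1, hmK⟩ := Finset.mem_Icc.1 hm
  have hp0 : (p : ℂ) ≠ 0 := by exact_mod_cast (Fact.out : p.Prime).ne_zero
  set D : ℝ := 20 / (1 - w) with hD
  have hD0 : 0 ≤ D := div_nonneg (by norm_num) (by linarith)
  set c : ℂ := ((m * a m * w ^ m : ℝ) : ℂ) with hc
  set U : ZMod p → ℂ := fun z => c * (ψ z + ψ⁻¹ z) with hU
  set R : ZMod p → ℂ := fun z => ∑ r ∈ Finset.Icc 2 K,
    ((m * a (r * m) * w ^ (r * m) : ℝ) : ℂ) * (ψ (r * z) + ψ⁻¹ (r * z)) with hR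
  have hY : ∀ z, localSum ψ a w K m z = U z + R z := by
    intro z
    rw [localSum, ← Finset.add_sum_Ioc_eq_sum_Icc (hm1.trans hmK),
      ← Finset.Icc_add_one_left_eq_Ioc]
    simp [hU, hR, hc]
  have hmin : min (m * β) 1 ≤ 1 := min_le_right _ _
  have hYb : ∀ z, ‖U z + R z‖ ≤ D * w ^ m := fun z => by
    rw [← hY]
    refine (norm_localSum_le ha hw0 hw1 ψ m hm1 z).trans ?_
    rw [mul_right_comm]
    exact mul_le_of_le_one_right (by positivity) hmin
  have hRb : ∀ z, ‖R z‖ ≤ D * w ^ (2 * m) := fun z => by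
    refine (norm_sum_localTerm_le ha hw0 hw1 ψ m 2 hm1 (by norm_num) z).trans ?_
    rw [mul_right_comm]
    exact mul_le_of_le_one_right (by positivity) hmin
  have hw2 : w ^ (2 * m) ≤ w ^ m := pow_le_pow_of_le_one hw0.le hw1.le (by omega)
  have hw3 : w ^ m * w ^ (2 * m) = w ^ (3 * m) := by rw [← pow_add]; congr 1; ring
  have hEU : (∑ z, U z) = 0 := by
    have h := sum_charPair hψ 1
    rw [if_neg fun h => (Fact.out : p.Prime).one_lt.ne' (Nat.dvd_one.1 h)] at h
    simp only [Nat.cast_one, one_mul] at h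
    rw [hU, ← Finset.mul_sum, h, mul_zero]
  have hEU2 : (∑ z, U z ^ 2) / (p : ℂ) = ((2 * (m * a m * w ^ m) ^ 2 : ℝ) : ℂ) := by
    simp only [hU, mul_pow]
    rw [← Finset.mul_sum, sum_charPair_sq hp hψ, hc]
    push_cast
    field_simp
  -- U is the term r = 1, which has mean zero, and R is the tail r ≥ 2. With Y = U + R one has Y² -
  -- U² = (2Y - R)R, a product of sizes w^m and w^{2m}; the squared mean is that of R alone.
  have e : PowerSeries.coeff 1 (logDerivSeries (momentSeries (localSum ψ a w K m))) -
      ((2 * (m * a m * w ^ m) ^ 2 : ℝ) : ℂ) =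
      (∑ z, (2 * (U z + R z) - R z) * R z) / (p : ℂ) - ((∑ z, R z) / (p : ℂ)) ^ 2 := by
    rw [coeff_one_logDerivSeries_momentSeries, ← hEU2]
    simp only [hY]
    rw [Finset.sum_add_distrib (f := U), hEU, zero_add, sub_right_comm, ← sub_div,
      ← Finset.sum_sub_distrib]
    congr 2
    refine Finset.sum_congr rfl fun z _ => ?_
    ring
  rw [e]
  have h1 : ‖(∑ z, (2 * (U z + R z) - R z) * R z) / (p : ℂ)‖ ≤ 3 * D ^ 2 * w ^ (3 * m) := by
    refine norm_sum_div_card_le fun z => ?_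
    rw [norm_mul]
    have h3 : ‖2 * (U z + R z) - R z‖ ≤ 3 * D * w ^ m := by
      refine (norm_sub_le _ _).trans ?_
      rw [norm_mul, Complex.norm_ofNat]
      have h4 := hYb z
      have h5 := (hRb z).trans (mul_le_mul_of_nonneg_left hw2 hD0)
      linarith
    calc _ ≤ (3 * D * w ^ m) * (D * w ^ (2 * m)) :=
          mul_le_mul h3 (hRb z) (norm_nonneg _) (by positivity)
      _ = 3 * D ^ 2 * (w ^ m * w ^ (2 * m)) := by ring
      _ = _ := by rw [hw3]
  have h2 : ‖((∑ z, R z) / (p : ℂ)) ^ 2‖ ≤ D ^ 2 * w ^ (3 * m) := by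
    rw [norm_pow]
    calc _ ≤ (D * w ^ (2 * m)) ^ 2 :=
          pow_le_pow_left₀ (norm_nonneg _) (norm_sum_div_card_le hRb) 2
      _ = D ^ 2 * (w ^ (2 * m) * w ^ (2 * m)) := by ring
      _ ≤ D ^ 2 * (w ^ m * w ^ (2 * m)) := by gcongr
      _ = _ := by rw [hw3]
  refine (norm_sub_le _ _).trans ((add_le_add h1 h2).trans_eq (by ring))

theorem abs_count_mul_sub_one_le (hq : 2 ≤ q) (hw0 : 0 < w) (hw1 : w < 1) (hwq : w ^ 2 * q = 1)
    (hN : ∀ k, k ≠ 0 → ∑ m ∈ k.divisors, m * N m = q ^ k) (m : ℕ) (hm : 1 ≤ m) :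
    |m * (N m : ℝ) * w ^ (2 * m) - 1| ≤ 2 * w ^ m := by
  have hqw : ∀ k : ℕ, (q : ℝ) ^ k * w ^ (2 * k) = 1 := fun k => by
    rw [pow_mul, ← mul_pow, mul_comm, hwq, one_pow]
  have h2 : (q : ℝ) ^ m ≤ m * N m + 2 * q ^ (m / 2) := by
    exact_mod_cast pow_le_mul_count_add hq hN m hm
  have h3 : (q : ℝ) ^ (m / 2) * w ^ (2 * m) ≤ w ^ m := by
    calc _ = ((q : ℝ) ^ (m / 2) * w ^ (2 * (m / 2))) * w ^ (2 * m - 2 * (m / 2)) := by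
          rw [mul_assoc, ← pow_add]; congr 2; omega
      _ = w ^ (2 * m - 2 * (m / 2)) := by rw [hqw, one_mul]
      _ ≤ w ^ m := pow_le_pow_of_le_one hw0.le hw1.le (by omega)
  have h4 := mul_le_mul_of_nonneg_right h2 (pow_pos hw0 (2 * m)).le
  rw [hqw, add_mul] at h4
  have h5 := count_mul_le hN hwq m hm
  have h6 := pow_pos hw0 m
  rw [abs_le]
  constructor <;> linarith

/-- The leading local variance is 2(m a_m w^m)². As m N_m w^{2m} = 1 + O(w^m), summing over points
gives the sum of 2m a_m², and replacing a_m by `sincCoef` changes each of the K terms by O(1/K).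
What remains is the sine-squared sum times 2/π². -/
theorem exists_norm_cumulant_one_sub_le (hp : p ≠ 2) (η : ℝ) (hη : η < 1) (q : ℕ) (hq : 2 ≤ q)
    (w : ℝ) (hw0 : 0 < w) (hw1 : w < 1) (hwq : w ^ 2 * q = 1)
    (N : ℕ → ℕ) (hN : ∀ k, k ≠ 0 → ∑ m ∈ k.divisors, m * N m = q ^ k) :
    ∃ A : ℝ, ∀ (ψ : AddChar (ZMod p) ℂ) (a : ℕ → ℝ) (K : ℕ) (β : ℝ), ψ ≠ 1 → β ≤ η →
      AdmissibleWeights a K β →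
      ‖cumulant N ψ a w K 1 - 2 * ((Real.log (K * β) / (2 * Real.pi ^ 2) : ℝ) : ℂ)‖ ≤ A := by
  refine ⟨4 * (20 / (1 - w)) ^ 2 * (1 / (1 - w)) + 400 * (1 / (1 - w)) + 220 +
    (11 + 1 / (1 - η)), fun ψ a K β hψ hβη ha => ?_⟩
  have hw1' : 0 < 1 - w := by linarith
  have hK0 : (0 : ℝ) < K := by
    have := ha.lt_mul
    have := ha.pos
    by_contra h
    nlinarith
  have hgeom : ∑ m ∈ Finset.Icc 1 K, w ^ m ≤ 1 / (1 - w) := by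
    have := sum_pow_mul_le hw0.le hw1 1 le_rfl 1 K
    simp only [mul_one, pow_one] at this
    exact this.trans (by gcongr)
  have hma : ∀ m ∈ Finset.Icc 1 K, m * a m ^ 2 ≤ 100 := by
    intro m hm
    have hm1 : (1 : ℝ) ≤ m := by exact_mod_cast (Finset.mem_Icc.1 hm).1
    have h := ha.le_inv m (Finset.mem_Icc.1 hm).1
    rw [le_div_iff₀ (by linarith)] at h
    have h2 : (|a m| * m) ^ 2 ≤ 10 ^ 2 := pow_le_pow_left₀ (by positivity) h 2
    rw [mul_pow, sq_abs] at h2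
    nlinarith [sq_nonneg (a m), mul_nonneg (sq_nonneg (a m)) (by linarith : (0 : ℝ) ≤ m)]
  -- the variance of the leading terms
  have s1 : ‖cumulant N ψ a w K 1 -
      ((∑ m ∈ Finset.Icc 1 K, N m * (2 * (m * a m * w ^ m) ^ 2) : ℝ) : ℂ)‖ ≤
      4 * (20 / (1 - w)) ^ 2 * (1 / (1 - w)) := by
    rw [cumulant, Complex.ofReal_sum, ← Finset.sum_sub_distrib]
    calc _ ≤ ∑ m ∈ Finset.Icc 1 K, 4 * (20 / (1 - w)) ^ 2 * w ^ m := by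
          refine (norm_sum_le _ _).trans (Finset.sum_le_sum fun m hm => ?_)
          have hm1 := (Finset.mem_Icc.1 hm).1
          rw [Complex.ofReal_mul, Complex.ofReal_natCast, ← mul_sub, norm_mul,
            Complex.norm_natCast]
          calc _ ≤ (N m : ℝ) * (4 * (20 / (1 - w)) ^ 2 * w ^ (3 * m)) :=
                mul_le_mul_of_nonneg_left (norm_coeff_one_sub_le hp ha hw0 hw1 hψ m hm)
                  (Nat.cast_nonneg _)
            _ = 4 * (20 / (1 - w)) ^ 2 * ((N m : ℝ) * w ^ (2 * m)) * w ^ m := by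
                rw [show 3 * m = 2 * m + m by ring, pow_add]; ring
            _ ≤ 4 * (20 / (1 - w)) ^ 2 * 1 * w ^ m := by
                have := count_mul_le' hN hwq m hm1
                gcongr
            _ = _ := by ring
      _ ≤ _ := by rw [← Finset.mul_sum]; gcongr
  -- replacing the number of points by its main term
  have s2 : |∑ m ∈ Finset.Icc 1 K, N m * (2 * (m * a m * w ^ m) ^ 2) -
      ∑ m ∈ Finset.Icc 1 K, 2 * (m * a m ^ 2)| ≤ 400 * (1 / (1 - w)) := by
    rw [← Finset.sum_sub_distrib]
    calc _ ≤ ∑ m ∈ Finset.Icc 1 K, 400 * w ^ m := by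
          refine (Finset.abs_sum_le_sum_abs _ _).trans (Finset.sum_le_sum fun m hm => ?_)
          have hm1 := (Finset.mem_Icc.1 hm).1
          have e : N m * (2 * (m * a m * w ^ m) ^ 2) - 2 * (m * a m ^ 2) =
              2 * (m * a m ^ 2) * (m * (N m : ℝ) * w ^ (2 * m) - 1) := by
            rw [mul_comm 2 m, pow_mul]; ring
          rw [e, abs_mul, abs_of_nonneg (by positivity)]
          calc _ ≤ 2 * 100 * (2 * w ^ m) :=
                mul_le_mul (mul_le_mul_of_nonneg_left (hma m hm) (by norm_num))
                  (abs_count_mul_sub_one_le hq hw0 hw1 hwq hN m hm1) (abs_nonneg _) (by norm_num)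
            _ = _ := by ring
      _ ≤ _ := by rw [← Finset.mul_sum]; gcongr
  -- replacing the coefficients by those of the indicator function
  have s3 : |∑ m ∈ Finset.Icc 1 K, 2 * (m * a m ^ 2) -
      ∑ m ∈ Finset.Icc 1 K, 2 * (m * sincCoef β m ^ 2)| ≤ 220 := by
    rw [← Finset.sum_sub_distrib]
    calc _ ≤ ∑ m ∈ Finset.Icc 1 K, 220 / (K : ℝ) := by
          refine (Finset.abs_sum_le_sum_abs _ _).trans (Finset.sum_le_sum fun m hm => ?_)
          have hm1 := (Finset.mem_Icc.1 hm).1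
          have hm0 : (0 : ℝ) < m := by exact_mod_cast hm1
          have e : 2 * (m * a m ^ 2) - 2 * (m * sincCoef β m ^ 2) =
              2 * m * ((a m - sincCoef β m) * (a m + sincCoef β m)) := by ring
          rw [e, abs_mul, abs_mul (a m - _), abs_of_nonneg (by positivity)]
          have h1 : |a m + sincCoef β m| ≤ 11 / m := by
            refine (abs_add_le _ _).trans ((add_le_add (ha.le_inv m hm1)
              (abs_sincCoef_le_inv β m)).trans_eq ?_)
            ring
          calc _ ≤ 2 * (m : ℝ) * (10 / K * (11 / m)) :=
                mul_le_mul_of_nonneg_left (mul_le_mul (ha.approx m hm1) h1 (abs_nonneg _)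
                  (by positivity)) (by positivity)
            _ = 220 / K := by field_simp; norm_num
      _ = 220 := by
          rw [Finset.sum_const, Nat.card_Icc, nsmul_eq_mul, Nat.add_sub_cancel]
          field_simp
  have s4 : |∑ m ∈ Finset.Icc 1 K, 2 * (m * sincCoef β m ^ 2) -
      2 * (Real.log (K * β) / (2 * Real.pi ^ 2))| ≤ 11 + 1 / (1 - η) := by
    have hK : 1 / β < K := by rw [div_lt_iff₀ ha.pos]; exact ha.lt_mul
    have h := abs_sum_sin_sq_div_sub_log_le η β K hη ha.pos hβη hK
    have e : ∑ m ∈ Finset.Icc 1 K, 2 * (m * sincCoef β m ^ 2) -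
        2 * (Real.log (K * β) / (2 * Real.pi ^ 2)) = 2 / Real.pi ^ 2 *
        (∑ m ∈ Finset.Icc 1 K, Real.sin (Real.pi * m * β) ^ 2 / m - Real.log (K * β) / 2) := by
      rw [mul_sub, Finset.mul_sum]
      congr 1
      · refine Finset.sum_congr rfl fun m hm => ?_
        have hm0 : (m : ℝ) ≠ 0 := by
          have := (Finset.mem_Icc.1 hm).1
          exact_mod_cast (by omega : m ≠ 0)
        rw [sincCoef]
        field_simp
      · field_simp
    rw [e, abs_mul]
    refine le_trans (mul_le_of_le_one_left (abs_nonneg _) ?_) h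
    rw [abs_of_pos (by positivity), div_le_one (by positivity)]
    nlinarith [Real.pi_gt_three]
  have s234 : |∑ m ∈ Finset.Icc 1 K, N m * (2 * (m * a m * w ^ m) ^ 2) -
      2 * (Real.log (K * β) / (2 * Real.pi ^ 2))| ≤
      400 * (1 / (1 - w)) + 220 + (11 + 1 / (1 - η)) := by
    rw [abs_le] at s2 s3 s4 ⊢
    constructor <;> linarith [s2.1, s2.2, s3.1, s3.2, s4.1, s4.2]
  have e : cumulant N ψ a w K 1 - 2 * ((Real.log (K * β) / (2 * Real.pi ^ 2) : ℝ) : ℂ) =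
      (cumulant N ψ a w K 1 -
        ((∑ m ∈ Finset.Icc 1 K, N m * (2 * (m * a m * w ^ m) ^ 2) : ℝ) : ℂ)) +
      ((∑ m ∈ Finset.Icc 1 K, N m * (2 * (m * a m * w ^ m) ^ 2) -
        2 * (Real.log (K * β) / (2 * Real.pi ^ 2)) : ℝ) : ℂ) := by
    push_cast
    ring
  rw [e]
  refine (norm_add_le _ _).trans ?_
  rw [Complex.norm_real, Real.norm_eq_abs]
  linarith

end Variance

open Polynomial

/-! ### Passage to the random model and uniform asymptotics -/

section Assembly

open Classical in
/-- The monic irreducible polynomials of degree at most `K`. -/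
def pointsUpTo (F : Type*) [Field F] [Finite F] (K : ℕ) : Finset F[X] :=
  (Finset.Icc 1 K).biUnion (closedPoints F)

theorem mem_pointsUpTo {F : Type*} [Field F] [Finite F] {K : ℕ} {P : F[X]} :
    P ∈ pointsUpTo F K ↔ P.Monic ∧ Irreducible P ∧ P.natDegree ≤ K := by
  simp only [pointsUpTo, Finset.mem_biUnion, Finset.mem_Icc, mem_closedPoints]
  constructor
  · rintro ⟨m, ⟨-, h⟩, h1, h2, rfl⟩
    exact ⟨h1, h2, h⟩
  · rintro ⟨h1, h2, h3⟩
    exact ⟨P.natDegree, ⟨h2.natDegree_pos, h3⟩, h1, h2, rfl⟩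

theorem sum_pointsUpTo {F : Type*} [Field F] [Finite F] {M : Type*} [AddCommMonoid M] (K : ℕ)
    (g : ℕ → F[X] → M) :
    ∑ P ∈ pointsUpTo F K, g P.natDegree P =
      ∑ m ∈ Finset.Icc 1 K, ∑ P ∈ closedPoints F m, g m P := by
  classical
  rw [pointsUpTo, Finset.sum_biUnion]
  · refine Finset.sum_congr rfl fun m _ => Finset.sum_congr rfl fun P hP => ?_
    rw [(mem_closedPoints.1 hP).2.2]
  · intro i _ j _ hij
    refine Finset.disjoint_left.2 fun P hi hj => hij ?_
    rw [← (mem_closedPoints.1 hi).2.2, ← (mem_closedPoints.1 hj).2.2]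

/-- `q ^ (-1/2)` for `q = #F`. -/
def invSqrtCard (F : Type*) : ℝ := (√(Nat.card F : ℝ))⁻¹

theorem invSqrtCard_pow (F : Type*) (k : ℕ) :
    invSqrtCard F ^ k = ((Nat.card F : ℝ) ^ ((k : ℝ) / 2))⁻¹ := by
  rw [invSqrtCard, inv_pow, Real.sqrt_eq_rpow, ← Real.rpow_natCast, ← Real.rpow_mul
    (Nat.cast_nonneg _)]
  congr 2
  ring

section

variable (F : Type*) [Field F] [Finite F]

theorem invSqrtCard_pos : 0 < invSqrtCard F := by
  have : 0 < Nat.card F := Nat.card_pos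
  exact inv_pos.2 (Real.sqrt_pos.2 (by exact_mod_cast this))

theorem invSqrtCard_sq_mul : invSqrtCard F ^ 2 * (Nat.card F : ℕ) = 1 := by
  have : 0 < Nat.card F := Nat.card_pos
  have h : (0 : ℝ) < Nat.card F := by exact_mod_cast this
  rw [invSqrtCard, inv_pow, Real.sq_sqrt h.le, inv_mul_cancel₀ h.ne']

theorem invSqrtCard_lt_one : invSqrtCard F < 1 := by
  have h : (1 : ℝ) < Nat.card F := by exact_mod_cast Finite.one_lt_card
  exact inv_lt_one_of_one_lt₀ (by rw [Real.lt_sqrt zero_le_one]; linarith)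

end

variable {p : ℕ} [Fact p.Prime] {F : Type*} [Field F] [Finite F]

/-- The weighted sum is a sum of contributions of closed points. -/
theorem weightedSum_eq [CharP F p] [Algebra (ZMod p) F] (h : ℝ → ℝ) (a : ℕ → ℝ) (K : ℕ)
    (ha : ∀ k, K < k → a k = 0)
    (hc : ∀ k : ℤ, k.natAbs ∈ Finset.Icc 1 K → fourierCoef h k = a k.natAbs)
    (f : F[X]) (ψ : AddChar (ZMod p) ℂ) :
    weightedSum p F h K f ψ = ∑ P ∈ pointsUpTo F K,
      localSum ψ a (invSqrtCard F) K P.natDegree (localTrace p P f) := by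
  set w := invSqrtCard F with hw
  rw [sum_pointsUpTo K fun m P => localSum ψ a w K m (localTrace p P f)]
  have h1 : ∀ m, ∑ P ∈ closedPoints F m, localSum ψ a w K m (localTrace p P f) =
      ∑ r ∈ Finset.Icc 1 K, ∑ P ∈ closedPoints F m, ((m * a (r * m) * w ^ (r * m) : ℝ) : ℂ) *
        (ψ (r * localTrace p P f) + ψ⁻¹ (r * localTrace p P f)) := by
    intro m
    exact Finset.sum_comm
  rw [Finset.sum_congr rfl fun m _ => h1 m, sum_Icc_Icc_eq_sum_divisors K fun m r =>
    ∑ P ∈ closedPoints F m, ((m * a (r * m) * w ^ (r * m) : ℝ) : ℂ) *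
        (ψ (r * localTrace p P f) + ψ⁻¹ (r * localTrace p P f))]
  · rw [weightedSum]
    have h2 : ∀ j ∈ Finset.range K,
        (fourierCoef h ((j + 1 : ℕ) : ℤ) * charSum p F (j + 1) f ψ
          + fourierCoef h (-((j + 1 : ℕ) : ℤ)) * charSum p F (j + 1) f ψ⁻¹)
          / (((Nat.card F : ℝ) ^ (((j + 1 : ℕ) : ℝ) / 2) : ℝ) : ℂ) =
        (fun k : ℕ => ∑ m ∈ k.divisors, ∑ P ∈ closedPoints F m,
          ((m * a (k / m * m) * w ^ (k / m * m) : ℝ) : ℂ) *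
          (ψ ((k / m : ℕ) * localTrace p P f) + ψ⁻¹ ((k / m : ℕ) * localTrace p P f))) (j + 1) := by
      intro j hj
      have hj' := Finset.mem_range.1 hj
      rw [hc _ (by rw [Int.natAbs_natCast, Finset.mem_Icc]; omega),
        hc _ (by rw [Int.natAbs_neg, Int.natAbs_natCast, Finset.mem_Icc]; omega),
        Int.natAbs_neg, Int.natAbs_natCast, charSum_eq, charSum_eq, div_eq_mul_inv,
        ← Complex.ofReal_inv, ← invSqrtCard_pow, ← hw, ← mul_add, ← Finset.sum_add_distrib,
        Finset.mul_sum, Finset.sum_mul]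
      refine Finset.sum_congr rfl fun m hm => ?_
      rw [← Finset.sum_add_distrib, Finset.mul_sum, Finset.sum_mul]
      refine Finset.sum_congr rfl fun P _ => ?_
      rw [Nat.div_mul_cancel (Nat.dvd_of_mem_divisors hm)]
      push_cast
      ring
    rw [Finset.sum_congr rfl h2, Finset.range_eq_Ico, Finset.sum_Ico_add'
      (fun k : ℕ => ∑ m ∈ k.divisors, ∑ P ∈ closedPoints F m,
          ((m * a (k / m * m) * w ^ (k / m * m) : ℝ) : ℂ) *
          (ψ ((k / m : ℕ) * localTrace p P f) + ψ⁻¹ ((k / m : ℕ) * localTrace p P f))) 0 K 1,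
      show Finset.Ico (0 + 1) (K + 1) = Finset.Icc 1 K by ext; simp]
  · intro m r hlt
    refine Finset.sum_eq_zero fun P _ => ?_
    rw [mul_comm] at hlt
    rw [ha _ hlt]
    simp

/-- The exponential generating function of the moments of the random model. -/
def totalSeries (F : Type*) [Field F] [Finite F] (ψ : AddChar (ZMod p) ℂ) (a : ℕ → ℝ) (K : ℕ) :
    PowerSeries ℂ :=
  ∏ P ∈ pointsUpTo F K, momentSeries (localSum ψ a (invSqrtCard F) K P.natDegree)

theorem constantCoeff_totalSeries (ψ : AddChar (ZMod p) ℂ) (a : ℕ → ℝ) (K : ℕ) :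
    PowerSeries.constantCoeff (totalSeries F ψ a K) = 1 := by
  rw [totalSeries, map_prod]
  exact Finset.prod_eq_one fun P _ => constantCoeff_momentSeries _

theorem coeff_logDerivSeries_totalSeries (ψ : AddChar (ZMod p) ℂ) (a : ℕ → ℝ) (K i : ℕ) :
    PowerSeries.coeff i (logDerivSeries (totalSeries F ψ a K)) =
      cumulant (fun m => (closedPoints F m).card) ψ a (invSqrtCard F) K i := by
  rw [totalSeries, logDerivSeries_prod _ _ fun P _ => by
    rw [constantCoeff_momentSeries]; exact one_ne_zero]
  rw [map_sum, sum_pointsUpTo K fun m (_ : F[X]) => PowerSeries.coeff i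
    (logDerivSeries (momentSeries (localSum ψ a (invSqrtCard F) K m))), cumulant]
  refine Finset.sum_congr rfl fun m _ => ?_
  rw [Finset.sum_const, nsmul_eq_mul]

/-- Here n·K < d enters: the moment over the family is equal to that of the independent model, with
no error term. -/
theorem average_weightedSum_pow [CharP F p] (h : ℝ → ℝ) (a : ℕ → ℝ) (K : ℕ) (ha : ∀ k, K < k → a k = 0)
    (hc : ∀ k : ℤ, k.natAbs ∈ Finset.Icc 1 K → fourierCoef h k = a k.natAbs)
    (ψ : AddChar (ZMod p) ℂ) (d n : ℕ) (hd : d ≠ 0) (hpd : ¬ p ∣ d) (hn : n * K < d) :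
    average F p d (fun f => weightedSum p F h K f ψ ^ n) =
      (n.factorial : ℂ) * PowerSeries.coeff n (totalSeries F ψ a K) := by
  classical
  let _ : Algebra (ZMod p) F := ZMod.algebra F p
  simp only [weightedSum_eq (F := F) h a K ha hc]
  rw [average_sum_pow p d hd hpd (pointsUpTo F K)
    (fun P hP => ⟨(mem_pointsUpTo.1 hP).1, (mem_pointsUpTo.1 hP).2.1⟩) n K
    (fun P hP => (mem_pointsUpTo.1 hP).2.2) hn
    fun P z => localSum ψ a (invSqrtCard F) K P.natDegree z]
  have h1 := moment_sum_eq (ι := pointsUpTo F K) (Z := ZMod p)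
    (fun P => localSum ψ a (invSqrtCard F) K (P : F[X]).natDegree) n
  rw [Fintype.card_coe, ZMod.card] at h1
  rw [h1, totalSeries, ← Finset.prod_coe_sort (pointsUpTo F K) fun P =>
    momentSeries (localSum ψ a (invSqrtCard F) K P.natDegree)]

/-- The parameters in which the asymptotics are uniform. -/
structure Parameters (p : ℕ) (η : ℝ) where
  ψ : AddChar (ZMod p) ℂ
  K : ℕ
  β : ℝ
  s : ℝ
  ψ_ne : ψ ≠ 1
  β_pos : 0 < β
  β_le : β ≤ η
  lt_mul : 1 < K * β
  s_le : |s| ≤ 1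

/-- The Fourier coefficients of the Beurling-Selberg polynomial, extended by zero. -/
def Parameters.weight {η : ℝ} (x : Parameters p η) (k : ℕ) : ℝ :=
  if k ∈ Finset.Icc 1 x.K then selbergCoef x.K x.β x.s k else 0

open Asymptotics Filter in
theorem coeff_totalSeries_asymptotics [CharP F p] (hp : p ≠ 2) (η : ℝ) (hη : η < 1) (n : ℕ) :
    (fun x : Parameters p η => (PowerSeries.coeff (2 * n) (totalSeries F x.ψ x.weight x.K) -
        ((Real.log (x.K * x.β) / (2 * Real.pi ^ 2) : ℝ) : ℂ) ^ n / n.factorial) *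
          ((1 + Real.log (x.K * x.β) : ℝ) : ℂ))
      =O[⊤] (fun x => (1 + Real.log (x.K * x.β)) ^ n) ∧
    (fun x : Parameters p η => (PowerSeries.coeff (2 * n + 1) (totalSeries F x.ψ x.weight x.K) -
        ((2 * constC p (Nat.card F) x.β : ℝ) : ℂ) *
        (((Real.log (x.K * x.β) / (2 * Real.pi ^ 2) : ℝ) : ℂ) ^ n / n.factorial)) *
          ((1 + Real.log (x.K * x.β) : ℝ) : ℂ))
      =O[⊤] (fun x => x.β * (1 + Real.log (x.K * x.β)) ^ n) := by
  have hadm : ∀ x : Parameters p η, AdmissibleWeights x.weight x.K x.β := fun x =>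
    AdmissibleWeights.selberg x.K x.β x.s x.s_le x.β_pos (x.β_le.trans_lt hη) x.lt_mul
  have hw0 := invSqrtCard_pos F
  have hw1 := invSqrtCard_lt_one F
  have hwq := invSqrtCard_sq_mul F
  have hN : ∀ k, k ≠ 0 → ∑ m ∈ k.divisors, m * (closedPoints F m).card = Nat.card F ^ k :=
    sum_divisors_card_closedPoints p F
  have hq : 2 ≤ Nat.card F := Finite.one_lt_card
  have hlog : ∀ x : Parameters p η, 0 ≤ Real.log (x.K * x.β) := fun x =>
    Real.log_nonneg x.lt_mul.le
  obtain ⟨A₀, hA₀, h0⟩ := exists_norm_cumulant_zero_sub_le hp (Nat.card F) _ hw0 hw1 hwq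
    (fun m => (closedPoints F m).card) hN
  obtain ⟨A₁, h1⟩ := exists_norm_cumulant_one_sub_le hp η hη (Nat.card F) hq _ hw0 hw1 hwq
    (fun m => (closedPoints F m).card) hN
  refine moment_asymptotics
    (fun i (x : Parameters p η) =>
      PowerSeries.coeff i (logDerivSeries (totalSeries F x.ψ x.weight x.K)))
    (fun i x => PowerSeries.coeff i (totalSeries F x.ψ x.weight x.K)) (fun x => x.β)
    (fun x => 1 + Real.log (x.K * x.β)) _ _ ?_ ?_ ?_ ?_ ?_ ?_ ?_ ?_ ?_ n
  · intro x
    rw [PowerSeries.coeff_zero_eq_constantCoeff_apply, constantCoeff_totalSeries]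
  · intro n x
    exact succ_mul_coeff_succ (constantCoeff_totalSeries _ _ _) n
  -- The mean has error A₀/K, and 1 + log(Kβ) ≤ Kβ, so the product with `L` is at most A₀β.
  · refine isBigO_top.2 ⟨A₀, fun x => ?_⟩
    have hK0 : (0 : ℝ) < x.K := by
      by_contra h
      nlinarith [x.lt_mul, x.β_pos]
    have hl := Real.log_le_sub_one_of_pos (x := x.K * x.β) (by linarith [x.lt_mul])
    rw [coeff_logDerivSeries_totalSeries, norm_mul, Complex.norm_real, Real.norm_eq_abs,
      Real.norm_eq_abs, abs_of_pos x.β_pos, abs_of_nonneg (by linarith [hlog x])]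
    calc _ ≤ A₀ / x.K * (x.K * x.β) :=
          mul_le_mul (h0 x.ψ x.weight x.K x.β x.ψ_ne (hadm x)).1 (by linarith)
            (by linarith [hlog x]) (by positivity)
      _ = A₀ * x.β := by field_simp
  · refine isBigO_top.2 ⟨2 * A₀, fun x => ?_⟩
    have h := (h0 x.ψ x.weight x.K x.β x.ψ_ne (hadm x)).2
    rw [Complex.norm_real, Real.norm_eq_abs, abs_mul, abs_two, Real.norm_eq_abs,
      abs_of_pos x.β_pos]
    linarith
  · refine isBigO_top.2 ⟨A₁, fun x => ?_⟩
    rw [coeff_logDerivSeries_totalSeries, norm_one, mul_one]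
    exact h1 x.ψ x.weight x.K x.β x.ψ_ne x.β_le (hadm x)
  · refine isBigO_top.2 ⟨1, fun x => ?_⟩
    rw [Complex.norm_real, Real.norm_eq_abs, Real.norm_eq_abs, one_mul,
      abs_of_nonneg (div_nonneg (hlog x) (by positivity)),
      abs_of_nonneg (by linarith [hlog x])]
    have : Real.log (x.K * x.β) / (2 * Real.pi ^ 2) ≤ Real.log (x.K * x.β) :=
      div_le_self (hlog x) (by nlinarith [Real.pi_gt_three])
    linarith
  · intro i hi
    obtain ⟨A, hA⟩ := exists_norm_cumulant_le (p := p) (Nat.card F) _ hw0 hw1 hwq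
      (fun m => (closedPoints F m).card) hN i hi
    refine isBigO_top.2 ⟨A, fun x => ?_⟩
    rw [coeff_logDerivSeries_totalSeries, Real.norm_eq_abs, abs_of_pos x.β_pos]
    exact hA x.ψ x.weight x.K x.β (hadm x)
  · refine isBigO_top.2 ⟨1, fun x => ?_⟩
    rw [norm_one, Real.norm_eq_abs, abs_of_pos x.β_pos, mul_one]
    exact x.β_le.trans hη.le
  · intro x
    linarith [hlog x]

/-- The sums attached to the two Beurling-Selberg polynomials, in terms of the random model. -/
theorem exists_parameters [CharP F p] (η : ℝ) (ψ : AddChar (ZMod p) ℂ) (β : ℝ) (d K n : ℕ) (h : ℝ → ℝ)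
    (hn : 1 ≤ n) (hψ : ψ ≠ 1) (hβ : 0 < β) (hβη : β ≤ η) (hpd : ¬ p ∣ d)
    (hK : max 1 (1 / β) < (K : ℝ)) (hKd : (K : ℝ) < (d : ℝ) / (n : ℕ))
    (hh : h = selbergMajorant K β ∨ h = selbergMinorant K β) :
    ∃ x : Parameters p η, x.K = K ∧ x.β = β ∧
      average F p d (fun f => weightedSum p F h K f ψ ^ n) =
        (n.factorial : ℂ) * PowerSeries.coeff n (totalSeries F x.ψ x.weight x.K) := by
  have hKβ : 1 < K * β := by
    rw [← div_lt_iff₀ hβ]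
    exact (le_max_right _ _).trans_lt hK
  have hn0 : (0 : ℝ) < n := by exact_mod_cast hn
  have hnK : n * K < d := by
    rw [lt_div_iff₀ hn0] at hKd
    rw [mul_comm]
    exact_mod_cast hKd
  obtain ⟨s, hs, c₀, hexp⟩ : ∃ s : ℝ, |s| ≤ 1 ∧ ∃ c₀ : ℝ, ∀ y, h y = c₀ +
      ∑ k ∈ Finset.Icc 1 K, 2 * selbergCoef K β s k * Real.cos (2 * Real.pi * k * y) := by
    rcases hh with rfl | rfl
    · exact ⟨1, by norm_num, _, selbergMajorant_eq K β⟩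
    · exact ⟨-1, by norm_num, _, selbergMinorant_eq K β⟩
  refine ⟨⟨ψ, K, β, s, hψ, hβ, hβη, hKβ, hs⟩, rfl, rfl, ?_⟩
  refine average_weightedSum_pow h _ K (fun k hk => if_neg ?_) (fun k hk => ?_) ψ d n
    (by omega) hpd hnK
  · rw [Finset.mem_Icc]
    exact fun h => absurd h.2 (not_le.2 hk)
  · rw [fourierCoef_trigPoly K c₀ _ h hexp k hk]
    exact congrArg _ (if_pos hk).symm

/-- Divides the extra factor L back out, in integer powers because the exponent l - 1 is -1 when l =
0. -/
theorem norm_factorial_mul_sub_le {n l : ℕ} {m t : ℂ} {A B L : ℝ} (hL : 0 < L)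
    (h : ‖(m - t) * (L : ℂ)‖ ≤ A * (B * L ^ l)) :
    ‖(n.factorial : ℂ) * m - n.factorial * t‖ ≤ n.factorial * A * B * L ^ ((l : ℤ) - 1) := by
  rw [norm_mul, Complex.norm_real, Real.norm_eq_abs, abs_of_pos hL] at h
  rw [← mul_sub, norm_mul, Complex.norm_natCast, mul_assoc, mul_assoc]
  refine mul_le_mul_of_nonneg_left ?_ (Nat.cast_nonneg _)
  rw [zpow_sub_one₀ hL.ne', zpow_natCast, ← mul_assoc, ← div_eq_mul_inv, ← mul_div_assoc,
    le_div_iff₀ hL, mul_assoc]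
  exact h

end Assembly

end ArtinSchreier
end

/-! ### The moment asymptotics -/

theorem mainTheorem8 (p : ℕ) [Fact p.Prime] (hp : p ≠ 2)
    (F : Type*) [Field F] [Finite F] [CharP F p] (η : ℝ) (hη : η < 1) :
    (∀ ℓ : ℕ, 1 ≤ ℓ → ∃ A : ℝ, ∀ (ψ : AddChar (ZMod p) ℂ) (β : ℝ) (d K : ℕ) (h : ℝ → ℝ),
      ψ ≠ 1 → 0 < β → β ≤ η → ¬ p ∣ d →
      max 1 (1 / β) < (K : ℝ) → (K : ℝ) < (d : ℝ) / ((2 * ℓ : ℕ) : ℝ) →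
      (h = ArtinSchreier.selbergMajorant K β ∨ h = ArtinSchreier.selbergMinorant K β) →
      ‖ArtinSchreier.average F p d
            (fun f => ArtinSchreier.weightedSum p F h K f ψ ^ (2 * ℓ))
          - (((Nat.factorial (2 * ℓ) : ℝ) / ((Nat.factorial ℓ : ℝ) * (2 * Real.pi ^ 2) ^ ℓ)
              * Real.log (K * β) ^ ℓ : ℝ) : ℂ)‖
        ≤ A * (1 + Real.log (K * β)) ^ ((ℓ : ℤ) - 1)) ∧
    (∀ ℓ : ℕ, ∃ A : ℝ, ∀ (ψ : AddChar (ZMod p) ℂ) (β : ℝ) (d K : ℕ) (h : ℝ → ℝ),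
      ψ ≠ 1 → 0 < β → β ≤ η → ¬ p ∣ d →
      max 1 (1 / β) < (K : ℝ) → (K : ℝ) < (d : ℝ) / ((2 * ℓ + 1 : ℕ) : ℝ) →
      (h = ArtinSchreier.selbergMajorant K β ∨ h = ArtinSchreier.selbergMinorant K β) →
      ‖ArtinSchreier.average F p d
            (fun f => ArtinSchreier.weightedSum p F h K f ψ ^ (2 * ℓ + 1))
          - ((2 * ArtinSchreier.constC p (Nat.card F) β
              * ((Nat.factorial (2 * ℓ + 1) : ℝ)
                / ((Nat.factorial ℓ : ℝ) * (2 * Real.pi ^ 2) ^ ℓ))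
              * Real.log (K * β) ^ ℓ : ℝ) : ℂ)‖
        ≤ A * β * (1 + Real.log (K * β)) ^ ((ℓ : ℤ) - 1)) := by
  constructor
  · intro ℓ hℓ
    obtain ⟨A, hA⟩ := Asymptotics.isBigO_top.1
      (ArtinSchreier.coeff_totalSeries_asymptotics (F := F) hp η hη ℓ).1
    refine ⟨(2 * ℓ).factorial * A, fun ψ β d K h hψ hβ hβη hpd hK hKd hh => ?_⟩
    obtain ⟨x, rfl, rfl, hx⟩ := ArtinSchreier.exists_parameters (F := F) η ψ β d K (2 * ℓ) h
      (by omega) hψ hβ hβη hpd hK hKd hh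
    have hL : 0 < 1 + Real.log (x.K * x.β) := by linarith [Real.log_nonneg x.lt_mul.le]
    have hAx := hA x
    -- For even moments the factor B of `norm_factorial_mul_sub_le` is 1; for odd ones below it is
    -- β.
    rw [Real.norm_eq_abs, abs_of_pos (pow_pos hL ℓ), ← one_mul ((1 + _) ^ ℓ)] at hAx
    have := ArtinSchreier.norm_factorial_mul_sub_le (n := 2 * ℓ) hL hAx
    rw [mul_one] at this
    rw [hx]
    convert this using 3
    push_cast
    rw [div_pow]
    ring
  · intro ℓ
    obtain ⟨A, hA⟩ := Asymptotics.isBigO_top.1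
      (ArtinSchreier.coeff_totalSeries_asymptotics (F := F) hp η hη ℓ).2
    refine ⟨(2 * ℓ + 1).factorial * A, fun ψ β d K h hψ hβ hβη hpd hK hKd hh => ?_⟩
    obtain ⟨x, rfl, rfl, hx⟩ := ArtinSchreier.exists_parameters (F := F) η ψ β d K (2 * ℓ + 1) h
      (by omega) hψ hβ hβη hpd hK hKd hh
    have hL : 0 < 1 + Real.log (x.K * x.β) := by linarith [Real.log_nonneg x.lt_mul.le]
    have hAx := hA x
    rw [Real.norm_eq_abs, abs_of_pos (mul_pos x.β_pos (pow_pos hL ℓ))] at hAx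
    have := ArtinSchreier.norm_factorial_mul_sub_le (n := 2 * ℓ + 1) hL hAx
    rw [hx]
    convert this using 3
    push_cast
    rw [div_pow]
    ring
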